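/- Let $d_1,d_2,n$ be natural numbers and $d=d_1+d_2$; write $\mathbf x\in\mathbb R^d$ as the concatenation of $\mathbf x^{(1)}\in\mathbb R^{d_1}$ and $\mathbf x^{(2)}\in\mathbb R^{d_2}$, and let $\mathbf x^-$ denote the concatenation of $\mathbf x^{(1)}$ and $-\mathbf x^{(2)}$. Let the ground truth $\mathbf x_\star\in\mathbb R^d$ be fixed, with nonzero blocks and balanced, i.e. $\|\mathbf x_\star^{(1)}\|=\|\mathbf x_\star^{(2)}\|$. Let $\mathbf a_i^{(k)}\sim\mathrm{Normal}(\mathbf 0,\mathbf I_{d_k})$, $1\le i\le n$, $k=1,2$, be independent, let $\mathbf a_i^{\pm}$ be the concatenation of $\mathbf a_i^{(1)}$ and $\pm\mathbf a_i^{(2)}$, let $f_i^{\pm}(\mathbf x)=\frac14|\langle\mathbf a_i^{\pm},\mathbf x\rangle|^2$, and observe $$y_i=\langle\mathbf a_i^{(1)},\mathbf x_\star^{(1)}\rangle\langle\mathbf x_\star^{(2)},\mathbf a_i^{(2)}\rangle=f_i^+(\mathbf x_\star)-f_i^-(\mathbf x_\star),\qquad i=1,\dots,n.$$ Let $f^\pm$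 be a generic copy of $f_i^\pm$ and set $$\lambda_{\mathcal D}=\inf_{\mathbf z\in\mathcal S}\ \tfrac12\,\mathbb E\left|\langle\nabla f^+(\mathbf x_\star)-\nabla f^-(\mathbf x_\star),\mathbf z\rangle\right|,\qquad \mathcal S=\left\{\mathbf z\in\mathbb R^d:\ \|\mathbf z\|=1,\ |\langle\mathbf z,\mathbf x_\star^-\rangle|\le\tfrac12\|\mathbf x_\star\|\right\}.$$ There is an absolute constant $C>0$ such that the following holds for all such $d_1,d_2,n,\mathbf x_\star$, all $\varepsilon\in[7/8,1)$ and all $\delta\in(0,1]$. If $$n\ \ge\ C\,\varepsilon^{-4}\max\left\{d,\log\tfrac8\delta\right\},$$ then with probability at least $1-\delta$ the following is true for every $\mathbf a_0\in\mathbb R^d$ (which may depend on the data) satisfying the oracle condition $$\left\|\mathbf a_0-\frac1{2n}\sum_{i=1}^n\left(\nabla f_i^+(\mathbf x_\star)+\nabla f_i^-(\mathbf x_\star)\right)\right\|\le\frac{1-\varepsilon}2\,\lambda_{\mathcal D}:$$ the convex program $$\operatorname*{maximize}_{\mathbf x\in\mathbb R^d}\quad \langle\mathbf a_0,\mathbf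 x\rangle-\frac1n\sum_{i=1}^n\max\left\{f_i^+(\mathbf x)-y_i,\ f_i^-(\mathbf x)\right\}$$ has exactly one solution $\widehat{\mathbf x}$, there is exactly one point $\widehat{\mathbf x}_\star$ closest to $\widehat{\mathbf x}$ in Euclidean norm among the reciprocal rescalings $\{(t\mathbf x_\star^{(1)},t^{-1}\mathbf x_\star^{(2)}):t\in\mathbb R\setminus\{0\}\}$ of the ground truth, and $\widehat{\mathbf x}=\widehat{\mathbf x}_\star$. -/

import Mathlib

open MeasureTheory ProbabilityTheory

namespace BilinearRegression

/-- `ℝ^d` with the Euclidean norm. -/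
abbrev Vec (d : ℕ) : Type := EuclideanSpace ℝ (Fin d)

/-- `ℝ^(d₁ + d₂)` with the Euclidean norm, a vector being partitioned into its two blocks. -/
abbrev Cat (d₁ d₂ : ℕ) : Type := WithLp 2 (Vec d₁ × Vec d₂)

/-- The concatenation of `u` and `v`. -/
def concat {d₁ d₂ : ℕ} (u : Vec d₁) (v : Vec d₂) : Cat d₁ d₂ := WithLp.toLp 2 (u, v)

/-- `x⁻`, the concatenation of `x⁽¹⁾` and `-x⁽²⁾`. -/
def flip {d₁ d₂ : ℕ} (x : Cat d₁ d₂) : Cat d₁ d₂ := concat x.fst (-x.snd)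

/-- `f⁺(x) = (1/4) |⟨a⁺, x⟩|²` for the data pair `a = (a⁽¹⁾, a⁽²⁾)`,
where `a⁺` is the concatenation of `a⁽¹⁾` and `a⁽²⁾`. -/
noncomputable def fPos {d₁ d₂ : ℕ} (a : Vec d₁ × Vec d₂) (x : Cat d₁ d₂) : ℝ :=
  1 / 4 * |inner ℝ (concat a.1 a.2) x| ^ 2

/-- `f⁻(x) = (1/4) |⟨a⁻, x⟩|²` for the data pair `a = (a⁽¹⁾, a⁽²⁾)`,
where `a⁻` is the concatenation of `a⁽¹⁾` and `-a⁽²⁾`. -/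
noncomputable def fNeg {d₁ d₂ : ℕ} (a : Vec d₁ × Vec d₂) (x : Cat d₁ d₂) : ℝ :=
  1 / 4 * |inner ℝ (concat a.1 (-a.2)) x| ^ 2

/-- The noiseless bilinear measurement `⟨a⁽¹⁾, x⁽¹⁾⟩ ⟨x⁽²⁾, a⁽²⁾⟩`. -/
noncomputable def measurement {d₁ d₂ : ℕ} (xs : Cat d₁ d₂) (a : Vec d₁ × Vec d₂) : ℝ :=
  inner ℝ a.1 xs.fst * inner ℝ xs.snd a.2

/-- The bilinear measurement is the difference of the two quadratics. -/
theorem measurement_eq {d₁ d₂ : ℕ} (xs : Cat d₁ d₂) (a : Vec d₁ × Vec d₂) :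
    measurement xs a = fPos a xs - fNeg a xs := by
  simp only [measurement, fPos, fNeg, concat, WithLp.prod_inner_apply, sq_abs, inner_neg_left,
    real_inner_comm a.2 xs.snd]
  simp only [WithLp.fst, WithLp.snd]
  ring

/-- `q(z) = (1/2) |⟨∇f⁺(x⋆) - ∇f⁻(x⋆), z⟩|`. -/
noncomputable def q {d₁ d₂ : ℕ} (xs : Cat d₁ d₂) (a : Vec d₁ × Vec d₂) (z : Cat d₁ d₂) : ℝ :=
  1 / 2 * |inner ℝ (gradient (fPos a) xs - gradient (fNeg a) xs) z|

/-- The law of `(a⁽¹⁾, a⁽²⁾)`: independent standard Gaussian vectors. -/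
noncomputable def dataLaw (d₁ d₂ : ℕ) : Measure (Vec d₁ × Vec d₂) :=
  (stdGaussian (Vec d₁)).prod (stdGaussian (Vec d₂))

/-- The restriction set: unit vectors `z` with `|⟨z, x⋆⁻⟩| ≤ ‖x⋆‖ / 2`. -/
def restrictionSet {d₁ d₂ : ℕ} (xs : Cat d₁ d₂) : Set (Cat d₁ d₂) :=
  {z | ‖z‖ = 1 ∧ |inner ℝ z (flip xs)| ≤ 1 / 2 * ‖xs‖}

/-- `λ_D`, the infimum of `E q(z)` over the restriction set. -/
noncomputable def lambdaD {d₁ d₂ : ℕ} (xs : Cat d₁ d₂) : ℝ :=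
  ⨅ z : restrictionSet xs, ∫ a, q xs a z ∂(dataLaw d₁ d₂)

/-- The condition on the output `a₀` of the approximation oracle:
`‖a₀ - (1/2n) ∑ᵢ (∇fᵢ⁺(x⋆) + ∇fᵢ⁻(x⋆))‖ ≤ ((1 - ε)/2) λ_D`. -/
def ApproxOracle {d₁ d₂ n : ℕ} (ε : ℝ) (xs : Cat d₁ d₂) (a : Fin n → Vec d₁ × Vec d₂)
    (a₀ : Cat d₁ d₂) : Prop :=
  ‖a₀ - (1 / (2 * (n : ℝ))) • ∑ i, (gradient (fPos (a i)) xs + gradient (fNeg (a i)) xs)‖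
    ≤ (1 - ε) / 2 * lambdaD xs

/-- The objective of the anchored program,
`⟨a₀, x⟩ - (1/n) ∑ᵢ max {fᵢ⁺(x) - yᵢ, fᵢ⁻(x)}`. -/
noncomputable def objective {d₁ d₂ n : ℕ} (a : Fin n → Vec d₁ × Vec d₂) (y : Fin n → ℝ)
    (a₀ x : Cat d₁ d₂) : ℝ :=
  inner ℝ a₀ x - 1 / (n : ℝ) * ∑ i, max (fPos (a i) x - y i) (fNeg (a i) x)

/-- The set of solutions (global maximizers) of the anchored program. -/
def solutions {d₁ d₂ n : ℕ} (a : Fin n → Vec d₁ × Vec d₂) (y : Fin n → ℝ)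
    (a₀ : Cat d₁ d₂) : Set (Cat d₁ d₂) :=
  {x | ∀ x', objective a y a₀ x' ≤ objective a y a₀ x}

/-- All reciprocal rescalings of the ground truth. -/
def equivalents {d₁ d₂ : ℕ} (xs : Cat d₁ d₂) : Set (Cat d₁ d₂) :=
  {x | ∃ t : ℝ, t ≠ 0 ∧ x.fst = t • xs.fst ∧ x.snd = t⁻¹ • xs.snd}

/-- The set of reciprocal rescalings of the ground truth that are closest to `xh`. -/
def closestEquivalents {d₁ d₂ : ℕ} (xs xh : Cat d₁ d₂) : Set (Cat d₁ d₂) :=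
  {x | x ∈ equivalents xs ∧ ∀ x' ∈ equivalents xs, ‖xh - x‖ ≤ ‖xh - x'‖}

end BilinearRegression

/-! At any rescaling `rescale xs t` the two arguments of each maximum coincide. Moving from there by
`z` therefore changes a maximum by the mean of its two derivatives, plus half the absolute value of
the differential of the measurement, plus a nonnegative quadratic term. Averaged over the sample,
the absolute values form a sharp penalty, and `rescale xs t` is the unique maximizer once this
penalty beats the linear functional `anchorGap`.

The penalty vanishes along the tangent `flip (rescale xs t)` of the curve of rescalings, so
`anchorGap` must vanish there too. This condition selects `t`: the oracle error displaces `t` from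
1, and the intermediate value theorem finds it in [0.9, 1.1]
(`exists_anchorGap_flip_rescale_eq_zero`). Transversally, with r the norm of `xs.fst` and w the
transversal component after undoing the rescaling, the penalty is at least 0.275 r‖w‖, while the
oracle error and the displacement of `t` cost at most 0.209 r‖w‖ (`anchorGap_rescaled_lt`). Along
the tangent itself the quadratic term gives strictness (`solutions_eq_singleton_rescale`).

All of this uses only the inequalities in `RegularSample`. They involve the sample but not `a₀`, so
a single event serves every anchor. They hold with high probability by Chernoff bounds on 0.01-nets
(`measureReal_not_regularSample_le`). The lower bound rests on the differential having mean absolute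
value at least 2/π times its standard deviation (`two_div_pi_mul_sqrt_crossVar_le`). -/

namespace BilinearRegression

/-! ### Volumetric bounds for nets. -/

section Nets

open Metric Module Function in
/-- An `η`-separated subset of the unit ball has at most `(1 + 2 / η) ^ dim` elements. -/
theorem card_le_of_separated {E : Type*} [NormedAddCommGroup E] [NormedSpace ℝ E]
    [FiniteDimensional ℝ E] {η : ℝ} (hη : 0 < η) (s : Finset E) (hs : ∀ c ∈ s, ‖c‖ ≤ 1)
    (h : ∀ c ∈ s, ∀ d ∈ s, c ≠ d → η ≤ ‖c - d‖) :
    (s.card : ℝ) ≤ (1 + 2 / η) ^ finrank ℝ E := by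
  borelize E
  let μ : Measure E := Measure.addHaar
  have hδ : 0 < η / 2 := by positivity
  have hρ : 0 < 1 + η / 2 := by positivity
  -- Balls of radius η/2 about the points are disjoint and lie in the ball of radius 1 + η/2;
  -- volumes are compared.
  have hdisj : Set.Pairwise (s : Set E) (Disjoint on fun c => ball (c : E) (η / 2)) := by
    rintro c hc d hd hcd
    apply ball_disjoint_ball
    rw [dist_eq_norm]
    linarith [h c hc d hd hcd]
  have hsub : (⋃ c ∈ s, ball (c : E) (η / 2)) ⊆ ball (0 : E) (1 + η / 2) := by
    refine Set.iUnion₂_subset fun x hx => ball_subset_ball' ?_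
    rw [dist_zero_right]
    linarith [hs x hx]
  have hvol : (s.card : ENNReal) * ENNReal.ofReal ((η / 2) ^ finrank ℝ E) * μ (ball 0 1) ≤
      ENNReal.ofReal ((1 + η / 2) ^ finrank ℝ E) * μ (ball 0 1) :=
    calc
      _ = μ (⋃ c ∈ s, ball (c : E) (η / 2)) := by
        rw [measure_biUnion_finset hdisj fun c _ => measurableSet_ball]
        simp only [μ.addHaar_ball_of_pos _ hδ, Finset.sum_const, nsmul_eq_mul, mul_assoc]
      _ ≤ μ (ball (0 : E) (1 + η / 2)) := measure_mono hsub
      _ = _ := by simp only [μ.addHaar_ball_of_pos _ hρ]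
  have hle := (ENNReal.mul_le_mul_iff_left (measure_ball_pos μ _ zero_lt_one).ne'
    measure_ball_lt_top.ne).1 hvol
  have hreal : (s.card : ℝ) * (η / 2) ^ finrank ℝ E ≤ (1 + η / 2) ^ finrank ℝ E := by
    have := ENNReal.toReal_le_of_le_ofReal (by positivity) hle
    simpa [ENNReal.toReal_mul, ENNReal.toReal_ofReal (pow_nonneg hδ.le (finrank ℝ E))] using this
  rw [← le_div_iff₀ (by positivity), ← div_pow] at hreal
  refine hreal.trans_eq ?_
  congr 1
  field_simp
  ring

open Module in
/-- Every subset of the unit ball has an `η`-net with at most `(1 + 2 / η) ^ dim` elements. -/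
theorem exists_net {E : Type*} [NormedAddCommGroup E] [NormedSpace ℝ E]
    [FiniteDimensional ℝ E] {η : ℝ} (hη : 0 < η) (S : Set E) (hS : ∀ c ∈ S, ‖c‖ ≤ 1) :
    ∃ N : Finset E, (↑N : Set E) ⊆ S ∧ (N.card : ℝ) ≤ (1 + 2 / η) ^ finrank ℝ E ∧
      ∀ x ∈ S, ∃ y ∈ N, ‖x - y‖ < η := by
  -- A separated set of largest cardinality is a net: a point far from all its members could be
  -- added. The volumetric bound `B` makes the maximum exist.
  classical
  let P : ℕ → Prop := fun k => ∃ N : Finset E, N.card = k ∧ (↑N : Set E) ⊆ S ∧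
    ∀ c ∈ N, ∀ d ∈ N, c ≠ d → η ≤ ‖c - d‖
  obtain ⟨B, hB⟩ := exists_nat_ge ((1 + 2 / η) ^ finrank ℝ E)
  have hP0 : P 0 := ⟨∅, by simp⟩
  obtain ⟨N, hN, hNS, hsep⟩ : P (Nat.findGreatest P B) := Nat.findGreatest_spec (Nat.zero_le _) hP0
  refine ⟨N, hNS, card_le_of_separated hη N (fun c hc => hS c (hNS hc)) hsep, fun x hx => ?_⟩
  by_contra! hfar
  have hxN : x ∉ N := fun hxN => by
    have := hfar x hxN
    simp at this
    linarith
  have hsep' : ∀ c ∈ insert x N, ∀ d ∈ insert x N, c ≠ d → η ≤ ‖c - d‖ := by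
    intro c hc d hd hcd
    rw [Finset.mem_insert] at hc hd
    rcases hc with rfl | hc <;> rcases hd with rfl | hd
    · exact absurd rfl hcd
    · exact hfar d hd
    · rw [norm_sub_rev]; exact hfar c hc
    · exact hsep c hc d hd hcd
  have hsub : (↑(insert x N) : Set E) ⊆ S := by
    intro c hc
    rw [Finset.coe_insert] at hc
    rcases hc with rfl | hc
    exacts [hx, hNS hc]
  have hP : P (insert x N).card := ⟨_, rfl, hsub, hsep'⟩
  have hle : (insert x N).card ≤ B := by
    exact_mod_cast (card_le_of_separated hη _ (fun c hc => hS c (hsub hc)) hsep').trans hB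
  have := Nat.le_findGreatest hle hP
  rw [Finset.card_insert_of_notMem hxN] at this
  omega

end Nets

/-! ### Moments of standard Gaussian vectors along a direction. -/

section GaussianMoments

theorem integral_abs_gaussianReal_one : ∫ x, |x| ∂(gaussianReal 0 1) = √(2 / Real.pi) := by
  rw [integral_gaussianReal_eq_integral_smul one_ne_zero]
  have h1 : ∀ x : ℝ, gaussianPDFReal 0 1 x • |x|
      = (√(2 * Real.pi))⁻¹ * (|x| * Real.exp (-(1 / 2) * |x| ^ 2)) := by
    intro x
    simp only [gaussianPDFReal, NNReal.coe_one, mul_one, sub_zero, smul_eq_mul, sq_abs]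
    rw [show -x ^ 2 / 2 = -(1 / 2) * x ^ 2 by ring]
    ring
  simp_rw [h1]
  rw [integral_const_mul,
    integral_comp_abs (f := fun x : ℝ => x * Real.exp (-(1 / 2) * x ^ 2))]
  have h2 := integral_rpow_mul_exp_neg_mul_rpow (p := 2) (q := 1) (b := 1 / 2)
    (by norm_num) (by norm_num) (by norm_num)
  have h3 : ∫ x in Set.Ioi (0 : ℝ), x * Real.exp (-(1 / 2) * x ^ 2) = 1 := by
    have hval : (1 / 2 : ℝ) ^ (-(1 + 1) / 2 : ℝ) * (1 / 2) * Real.Gamma ((1 + 1) / 2) = 1 := by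
      norm_num [Real.rpow_neg_one]
    refine Eq.trans (setIntegral_congr_fun measurableSet_Ioi fun x _ => ?_) (h2.trans hval)
    simp
  rw [h3, Real.sqrt_mul (by norm_num), Real.sqrt_div (by norm_num)]
  have : √2 * √2 = (2 : ℝ) := Real.mul_self_sqrt (by norm_num)
  have hp : √Real.pi ≠ 0 := (Real.sqrt_pos.2 Real.pi_pos).ne'
  field_simp
  linarith

theorem integrable_exp_sq_gaussianReal_one :
    Integrable (fun x => Real.exp (1 / 4 * x ^ 2)) (gaussianReal 0 1) := by
  rw [gaussianReal_of_var_ne_zero _ one_ne_zero,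
    integrable_withDensity_iff (measurable_gaussianPDF _ _)
      (Filter.Eventually.of_forall fun _ => gaussianPDF_lt_top)]
  simp_rw [toReal_gaussianPDF]
  refine ((integrable_exp_neg_mul_sq (b := 1 / 4) (by norm_num)).const_mul
    (√(2 * Real.pi))⁻¹).congr (Filter.Eventually.of_forall fun x => ?_)
  simp only [gaussianPDFReal, NNReal.coe_one, mul_one, sub_zero]
  rw [mul_left_comm, ← Real.exp_add]
  ring_nf

theorem integral_exp_sq_gaussianReal_one :
    ∫ x, Real.exp (1 / 4 * x ^ 2) ∂(gaussianReal 0 1) = √2 := by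
  rw [integral_gaussianReal_eq_integral_smul one_ne_zero]
  have h1 : ∀ x : ℝ, gaussianPDFReal 0 1 x • Real.exp (1 / 4 * x ^ 2)
      = (√(2 * Real.pi))⁻¹ * Real.exp (-(1 / 4) * x ^ 2) := by
    intro x
    simp only [gaussianPDFReal, NNReal.coe_one, mul_one, sub_zero, smul_eq_mul]
    rw [mul_assoc, ← Real.exp_add]
    ring_nf
  simp_rw [h1]
  rw [integral_const_mul, integral_gaussian, ← Real.sqrt_inv,
    ← Real.sqrt_mul (by positivity)]
  congr 1
  have := Real.pi_pos.ne'
  field_simp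
  norm_num

variable {d : ℕ}

theorem hasLaw_inner_stdGaussian (b : Vec d) :
    HasLaw (fun a : Vec d => inner ℝ a b) (gaussianReal 0 (‖b‖ ^ 2).toNNReal)
      (stdGaussian (Vec d)) where
  aemeasurable := by fun_prop
  map_eq := by
    have h := IsGaussian.map_eq_gaussianReal (μ := stdGaussian (Vec d)) (innerSL ℝ b)
    rw [integral_strongDual_stdGaussian, variance_dual_stdGaussian, innerSL_apply_norm] at h
    rw [← h]
    congr 1
    ext a
    simp [real_inner_comm]

theorem hasLaw_inner_stdGaussian_of_norm_one {b : Vec d} (hb : ‖b‖ = 1) :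
    HasLaw (fun a : Vec d => inner ℝ a b) (gaussianReal 0 1) (stdGaussian (Vec d)) := by
  simpa [hb] using hasLaw_inner_stdGaussian b

theorem memLp_inner_stdGaussian (b : Vec d) :
    MemLp (fun a : Vec d => inner ℝ a b) 2 (stdGaussian (Vec d)) := by
  have h := (memLp_id_gaussianReal' (μ := 0) (v := (‖b‖ ^ 2).toNNReal) 2 (by simp))
  rw [← (hasLaw_inner_stdGaussian b).map_eq] at h
  exact h.comp_of_map (hasLaw_inner_stdGaussian b).aemeasurable

theorem integrable_inner_stdGaussian (b : Vec d) :
    Integrable (fun a : Vec d => inner ℝ a b) (stdGaussian (Vec d)) :=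
  (memLp_inner_stdGaussian b).integrable (by simp)

theorem integrable_inner_mul_inner_stdGaussian (b c : Vec d) :
    Integrable (fun a : Vec d => inner ℝ a b * inner ℝ a c) (stdGaussian (Vec d)) :=
  (memLp_inner_stdGaussian b).integrable_mul (memLp_inner_stdGaussian c)

theorem integral_abs_inner_stdGaussian (b : Vec d) :
    ∫ a, |inner ℝ a b| ∂(stdGaussian (Vec d)) = √(2 / Real.pi) * ‖b‖ := by
  by_cases hb : b = 0
  · simp [hb]
  have hb' : ‖b‖ ≠ 0 := norm_ne_zero_iff.2 hb
  have h := (hasLaw_inner_stdGaussian_of_norm_one (b := ‖b‖⁻¹ • b)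
    (by rw [norm_smul, norm_inv, norm_norm, inv_mul_cancel₀ hb'])).integral_comp
    (f := fun x => |x|) (by fun_prop)
  rw [integral_abs_gaussianReal_one] at h
  rw [← h, ← integral_mul_const]
  congr 1
  ext a
  simp only [Function.comp, inner_smul_right, abs_mul, abs_inv, abs_norm]
  field_simp

theorem integral_inner_sq_stdGaussian (b : Vec d) :
    ∫ a, (inner ℝ a b) ^ 2 ∂(stdGaussian (Vec d)) = ‖b‖ ^ 2 := by
  have h := variance_dual_stdGaussian (innerSL ℝ b : StrongDual ℝ (Vec d))
  rw [variance_of_integral_eq_zero (by fun_prop) (integral_strongDual_stdGaussian _),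
    innerSL_apply_norm] at h
  rw [← h]
  congr 1
  ext a
  simp [real_inner_comm]

theorem integral_inner_mul_inner_stdGaussian (b c : Vec d) :
    ∫ a, inner ℝ a b * inner ℝ a c ∂(stdGaussian (Vec d)) = inner ℝ b c := by
  have h := integral_inner_sq_stdGaussian (b + c)
  have hb := integrable_inner_mul_inner_stdGaussian b b
  have hc := integrable_inner_mul_inner_stdGaussian c c
  have hbc := (integrable_inner_mul_inner_stdGaussian b c).const_mul 2
  have he : ∀ a : Vec d, (inner ℝ a (b + c)) ^ 2 = (inner ℝ a b * inner ℝ a b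
      + 2 * (inner ℝ a b * inner ℝ a c)) + inner ℝ a c * inner ℝ a c := by
    intro a
    rw [inner_add_right]
    ring
  simp_rw [he] at h
  have hadd : Integrable (fun a : Vec d => inner ℝ a b * inner ℝ a b
      + 2 * (inner ℝ a b * inner ℝ a c)) (stdGaussian (Vec d)) := hb.add hbc
  rw [integral_add hadd hc, integral_add hb hbc, integral_const_mul] at h
  have h1 := integral_inner_sq_stdGaussian b
  have h2 := integral_inner_sq_stdGaussian c
  simp_rw [sq] at h1 h2
  rw [h1, h2, norm_add_sq_real] at h
  linarith

theorem integrable_exp_inner_sq_stdGaussian {b : Vec d} (hb : ‖b‖ = 1) :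
    Integrable (fun a : Vec d => Real.exp (1 / 4 * (inner ℝ a b) ^ 2)) (stdGaussian (Vec d)) := by
  have h := integrable_exp_sq_gaussianReal_one
  rw [← (hasLaw_inner_stdGaussian_of_norm_one hb).map_eq] at h
  exact h.comp_aemeasurable (hasLaw_inner_stdGaussian_of_norm_one hb).aemeasurable

theorem integral_exp_inner_sq_stdGaussian {b : Vec d} (hb : ‖b‖ = 1) :
    ∫ a, Real.exp (1 / 4 * (inner ℝ a b) ^ 2) ∂(stdGaussian (Vec d)) = √2 := by
  rw [← integral_exp_sq_gaussianReal_one]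
  exact (hasLaw_inner_stdGaussian_of_norm_one hb).integral_comp
    (f := fun x => Real.exp (1 / 4 * x ^ 2)) (by fun_prop)

end GaussianMoments

/-! ### Moments of the differential of the measurement. -/

section CrossForm

variable {d₁ d₂ : ℕ}

instance : IsProbabilityMeasure (dataLaw d₁ d₂) := by
  unfold dataLaw
  infer_instance

/-- The differential at `xs` of the bilinear measurement, in the direction `w`. -/
noncomputable def crossForm (xs w : Cat d₁ d₂) (a : Vec d₁ × Vec d₂) : ℝ :=
  inner ℝ a.2 xs.snd * inner ℝ a.1 w.fst + inner ℝ a.1 xs.fst * inner ℝ a.2 w.snd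

/-- The second moment of `crossForm xs w` under the law of the data. -/
noncomputable def crossVar (xs w : Cat d₁ d₂) : ℝ :=
  ‖xs.snd‖ ^ 2 * ‖w.fst‖ ^ 2 + 2 * (inner ℝ xs.fst w.fst * inner ℝ xs.snd w.snd)
    + ‖xs.fst‖ ^ 2 * ‖w.snd‖ ^ 2

@[fun_prop]
theorem continuous_crossForm (xs w : Cat d₁ d₂) : Continuous (crossForm xs w) := by
  unfold crossForm
  fun_prop

theorem integrable_and_integral_crossForm_sq (xs w : Cat d₁ d₂) :
    Integrable (fun a => crossForm xs w a ^ 2) (dataLaw d₁ d₂) ∧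
      ∫ a, crossForm xs w a ^ 2 ∂(dataLaw d₁ d₂) = crossVar xs w := by
  have he : (fun a : Vec d₁ × Vec d₂ => crossForm xs w a ^ 2) = fun a =>
      ((inner ℝ a.1 w.fst * inner ℝ a.1 w.fst) * (inner ℝ a.2 xs.snd * inner ℝ a.2 xs.snd)
      + 2 * ((inner ℝ a.1 xs.fst * inner ℝ a.1 w.fst) * (inner ℝ a.2 xs.snd * inner ℝ a.2 w.snd)))
      + (inner ℝ a.1 xs.fst * inner ℝ a.1 xs.fst) * (inner ℝ a.2 w.snd * inner ℝ a.2 w.snd) := by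
    ext a
    unfold crossForm
    ring
  have h1 : Integrable (fun a : Vec d₁ × Vec d₂ => (inner ℝ a.1 w.fst * inner ℝ a.1 w.fst)
      * (inner ℝ a.2 xs.snd * inner ℝ a.2 xs.snd)) (dataLaw d₁ d₂) :=
    (integrable_inner_mul_inner_stdGaussian w.fst w.fst).mul_prod
      (integrable_inner_mul_inner_stdGaussian xs.snd xs.snd)
  have h2 : Integrable (fun a : Vec d₁ × Vec d₂ => 2 * ((inner ℝ a.1 xs.fst * inner ℝ a.1 w.fst)
      * (inner ℝ a.2 xs.snd * inner ℝ a.2 w.snd))) (dataLaw d₁ d₂) :=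
    ((integrable_inner_mul_inner_stdGaussian xs.fst w.fst).mul_prod
      (integrable_inner_mul_inner_stdGaussian xs.snd w.snd)).const_mul 2
  have h3 : Integrable (fun a : Vec d₁ × Vec d₂ => (inner ℝ a.1 xs.fst * inner ℝ a.1 xs.fst)
      * (inner ℝ a.2 w.snd * inner ℝ a.2 w.snd)) (dataLaw d₁ d₂) :=
    (integrable_inner_mul_inner_stdGaussian xs.fst xs.fst).mul_prod
      (integrable_inner_mul_inner_stdGaussian w.snd w.snd)
  have h12 : Integrable (fun a : Vec d₁ × Vec d₂ => (inner ℝ a.1 w.fst * inner ℝ a.1 w.fst)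
      * (inner ℝ a.2 xs.snd * inner ℝ a.2 xs.snd)
      + 2 * ((inner ℝ a.1 xs.fst * inner ℝ a.1 w.fst)
      * (inner ℝ a.2 xs.snd * inner ℝ a.2 w.snd))) (dataLaw d₁ d₂) := h1.add h2
  rw [he]
  refine ⟨h12.add h3, ?_⟩
  rw [integral_add h12 h3, integral_add h1 h2, integral_const_mul]
  unfold dataLaw
  rw [integral_prod_mul (fun x : Vec d₁ => inner ℝ x w.fst * inner ℝ x w.fst)
      (fun y : Vec d₂ => inner ℝ y xs.snd * inner ℝ y xs.snd),
    integral_prod_mul (fun x : Vec d₁ => inner ℝ x xs.fst * inner ℝ x w.fst)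
      (fun y : Vec d₂ => inner ℝ y xs.snd * inner ℝ y w.snd),
    integral_prod_mul (fun x : Vec d₁ => inner ℝ x xs.fst * inner ℝ x xs.fst)
      (fun y : Vec d₂ => inner ℝ y w.snd * inner ℝ y w.snd)]
  simp only [integral_inner_mul_inner_stdGaussian, real_inner_self_eq_norm_sq, crossVar]
  ring

theorem integrable_crossForm (xs w : Cat d₁ d₂) :
    Integrable (crossForm xs w) (dataLaw d₁ d₂) :=
  ((memLp_two_iff_integrable_sq (continuous_crossForm xs w).aestronglyMeasurable).2
    (integrable_and_integral_crossForm_sq xs w).1).integrable (by simp)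

/-- With the second data vector frozen, the form is linear in the first, hence conditionally
Gaussian. -/
theorem crossForm_eq_inner (xs w : Cat d₁ d₂) (x : Vec d₁) (y : Vec d₂) :
    crossForm xs w (x, y)
      = inner ℝ x (inner ℝ y xs.snd • w.fst + inner ℝ y w.snd • xs.fst) := by
  simp only [crossForm, inner_add_right, inner_smul_right]
  ring

/-- The summands are the variances of the coordinates of the random vector paired with `x` in
`crossForm_eq_inner`. It follows that `crossVar` is nonnegative. -/
theorem norm_sq_smul_add_smul_apply_sum (xs w : Cat d₁ d₂) :
    ∑ k, ‖w.fst k • xs.snd + xs.fst k • w.snd‖ ^ 2 = crossVar xs w := by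
  have h : ∀ k, ‖w.fst k • xs.snd + xs.fst k • w.snd‖ ^ 2 = ‖xs.snd‖ ^ 2 * w.fst k ^ 2
      + 2 * ((w.fst k * xs.fst k) * inner ℝ xs.snd w.snd) + ‖w.snd‖ ^ 2 * xs.fst k ^ 2 := by
    intro k
    rw [norm_add_sq_real, norm_smul, norm_smul, inner_smul_left, inner_smul_right, mul_pow,
      mul_pow, Real.norm_eq_abs, Real.norm_eq_abs, sq_abs, sq_abs]
    simp
    ring
  simp_rw [h]
  rw [Finset.sum_add_distrib, Finset.sum_add_distrib, ← Finset.mul_sum, ← Finset.mul_sum,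
    ← Finset.mul_sum, ← Finset.sum_mul, ← EuclideanSpace.real_norm_sq_eq,
    ← EuclideanSpace.real_norm_sq_eq]
  have : ∑ k, w.fst k * xs.fst k = inner ℝ xs.fst w.fst := by
    simp [PiLp.inner_apply]
  rw [this, crossVar]
  ring

theorem crossVar_nonneg (xs w : Cat d₁ d₂) : 0 ≤ crossVar xs w := by
  rw [← norm_sq_smul_add_smul_apply_sum]
  positivity

/-- The first absolute moment of `crossForm` is at least `2 / π` times its standard deviation. -/
theorem two_div_pi_mul_sqrt_crossVar_le (xs w : Cat d₁ d₂) :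
    2 / Real.pi * √(crossVar xs w) ≤ ∫ a, |crossForm xs w a| ∂(dataLaw d₁ d₂) := by
  have hint : Integrable (fun a => |crossForm xs w a|) (dataLaw d₁ d₂) :=
    (integrable_crossForm xs w).abs
  -- Integrating out the first data vector gives one factor √(2/π). The second will come from the
  -- coordinates of the remaining vector.
  have hswap : ∫ a, |crossForm xs w a| ∂(dataLaw d₁ d₂)
      = ∫ y, √(2 / Real.pi) * ‖inner ℝ y xs.snd • w.fst + inner ℝ y w.snd • xs.fst‖
        ∂(stdGaussian (Vec d₂)) := by
    unfold dataLaw at hint ⊢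
    rw [integral_prod_symm _ hint]
    simp_rw [crossForm_eq_inner, integral_abs_inner_stdGaussian]
  set Λ := crossVar xs w with hΛ
  have hΛ0 : 0 ≤ Λ := crossVar_nonneg xs w
  rcases hΛ0.eq_or_lt with h0 | hpos
  · rw [← h0, Real.sqrt_zero, mul_zero]
    exact integral_nonneg fun a => abs_nonneg _
  set σ : Fin d₁ → Vec d₂ := fun k => w.fst k • xs.snd + xs.fst k • w.snd with hσ
  have hσΛ : ∑ k, ‖σ k‖ ^ 2 = Λ := norm_sq_smul_add_smul_apply_sum xs w
  -- Cauchy–Schwarz against the vector of coordinate deviations bounds the norm below by a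
  -- combination of absolute values of Gaussians, whose means are explicit.
  have hpt : ∀ y : Vec d₂, ∑ k, ‖σ k‖ * |inner ℝ y (σ k)|
      ≤ √Λ * ‖inner ℝ y xs.snd • w.fst + inner ℝ y w.snd • xs.fst‖ := by
    intro y
    refine (Real.sum_mul_le_sqrt_mul_sqrt _ _ _).trans_eq ?_
    rw [hσΛ, EuclideanSpace.norm_eq]
    congr 3
    ext k
    simp only [hσ, inner_add_right, inner_smul_right, sq_abs, Real.norm_eq_abs]
    simp
    ring
  have hZ : Integrable (fun y : Vec d₂ =>
      ‖inner ℝ y xs.snd • w.fst + inner ℝ y w.snd • xs.fst‖) (stdGaussian (Vec d₂)) :=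
    (((integrable_inner_stdGaussian xs.snd).smul_const _).add
      ((integrable_inner_stdGaussian w.snd).smul_const _)).norm
  have hint2 : √(2 / Real.pi) * Λ ≤ √Λ * ∫ y, ‖inner ℝ y xs.snd • w.fst
      + inner ℝ y w.snd • xs.fst‖ ∂(stdGaussian (Vec d₂)) := by
    rw [← integral_const_mul]
    refine le_trans (le_of_eq ?_) (integral_mono (integrable_finsetSum Finset.univ
      fun k _ => (integrable_inner_stdGaussian (σ k)).abs.const_mul ‖σ k‖) (hZ.const_mul _) hpt)
    rw [integral_finsetSum _ fun k _ =>
      (integrable_inner_stdGaussian (σ k)).abs.const_mul ‖σ k‖]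
    simp_rw [integral_const_mul, integral_abs_inner_stdGaussian]
    rw [← hσΛ, Finset.mul_sum]
    exact Finset.sum_congr rfl fun k _ => by ring
  rw [hswap, integral_const_mul]
  have hs : 0 < √Λ := Real.sqrt_pos.2 hpos
  have h2 : √(2 / Real.pi) * √Λ ≤ ∫ y, ‖inner ℝ y xs.snd • w.fst
      + inner ℝ y w.snd • xs.fst‖ ∂(stdGaussian (Vec d₂)) := by
    refine le_of_mul_le_mul_left ?_ hs
    refine le_trans (le_of_eq ?_) hint2
    rw [mul_left_comm, Real.mul_self_sqrt hΛ0]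
  calc 2 / Real.pi * √Λ = √(2 / Real.pi) * (√(2 / Real.pi) * √Λ) := by
        rw [← mul_assoc, Real.mul_self_sqrt (by positivity)]
    _ ≤ _ := by gcongr

end CrossForm

/-! ### Exponential tail bound for i.i.d. samples. -/

section Chernoff

variable {Ω X : Type*} [MeasurableSpace Ω] [MeasurableSpace X] {μ : Measure Ω}
  [IsProbabilityMeasure μ] {ν : Measure X} [IsProbabilityMeasure ν] {n : ℕ}

/-- Chernoff's bound for the empirical mean of a function of an i.i.d. sample. -/
theorem measureReal_le_sum_le_of_integral_exp_le {a : Fin n → Ω → X}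
    (ha : ∀ i, HasLaw (a i) ν μ) (hindep : iIndepFun a μ) {g : X → ℝ} (hg : Measurable g)
    {t κ c : ℝ} (ht : 0 ≤ t) (hint : Integrable (fun x => Real.exp (t * g x)) ν)
    (hexp : ∫ x, Real.exp (t * g x) ∂ν ≤ Real.exp (t * κ - c)) :
    μ.real {ω | (n : ℝ) * κ ≤ ∑ i, g (a i ω)} ≤ Real.exp (-(c * n)) := by
  have hm : ∀ i, AEMeasurable (fun ω => g (a i ω)) μ := fun i =>
    hg.comp_aemeasurable (ha i).aemeasurable
  have hI : iIndepFun (fun i ω => g (a i ω)) μ := hindep.comp (fun _ => g) fun _ => hg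
  have hmgf : ∀ i, mgf (fun ω => g (a i ω)) μ t ≤ Real.exp (t * κ - c) := fun i => by
    refine le_trans (le_of_eq ?_) hexp
    exact (ha i).integral_comp (f := fun x => Real.exp (t * g x))
      ((hg.const_mul t).exp.aestronglyMeasurable)
  have hsum : Integrable (fun ω => Real.exp (t * (∑ i, fun ω => g (a i ω)) ω)) μ := by
    have : (fun ω => Real.exp (t * (∑ i, fun ω => g (a i ω)) ω))
        = fun ω => ∏ i, Real.exp (t * g (a i ω)) := by
      ext ω
      rw [Finset.sum_apply, Finset.mul_sum, Real.exp_sum]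
    rw [this]
    have hlaw := hindep.hasLaw_pi ha
    have hpi : Integrable (fun x : Fin n → X => ∏ i, Real.exp (t * g (x i)))
        (Measure.pi fun _ => ν) := Integrable.fintype_prod fun _ => hint
    rw [← hlaw.map_eq] at hpi
    exact hpi.comp_aemeasurable hlaw.aemeasurable
  have h := measure_ge_le_exp_mul_mgf (μ := μ) (X := ∑ i, fun ω => g (a i ω)) ((n : ℝ) * κ) ht hsum
  rw [hI.mgf_sum₀ hm] at h
  simp only [Finset.sum_apply] at h
  refine h.trans ?_
  calc Real.exp (-t * (n * κ)) * ∏ i, mgf (fun ω => g (a i ω)) μ t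
      ≤ Real.exp (-t * (n * κ)) * ∏ _i : Fin n, Real.exp (t * κ - c) := by
        gcongr with i
        · exact fun i _ => mgf_nonneg
        · exact hmgf i
    _ = Real.exp (-(c * n)) := by
        rw [Finset.prod_const, Finset.card_univ, Fintype.card_fin, ← Real.exp_nat_mul,
          ← Real.exp_add]
        ring_nf

end Chernoff

/-! ### Tail bounds in a fixed direction. -/

section Tails

variable {Ω : Type*} [MeasurableSpace Ω] {μ : Measure Ω} [IsProbabilityMeasure μ]
  {d d₁ d₂ n : ℕ}

theorem measureReal_le_sum_inner_sq {a : Fin n → Ω → Vec d}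
    (ha : ∀ i, HasLaw (a i) (stdGaussian (Vec d)) μ) (hindep : iIndepFun a μ)
    {w : Vec d} (hw : ‖w‖ = 1) :
    μ.real {ω | (n : ℝ) * 1.9 ≤ ∑ i, (inner ℝ (a i ω) w) ^ 2} ≤ Real.exp (-(0.001 * n)) := by
  refine measureReal_le_sum_le_of_integral_exp_le ha hindep
    (g := fun x => (inner ℝ x w) ^ 2) (t := 1 / 4) (by fun_prop) (by norm_num)
    (integrable_exp_inner_sq_stdGaussian hw) ?_
  rw [integral_exp_inner_sq_stdGaussian hw]
  -- The moment √2 must lie below exp(1.9/4 - 0.001), and the quadratic Taylor bound is enough.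
  refine le_trans ?_ (Real.quadratic_le_exp_of_nonneg (by norm_num))
  rw [Real.sqrt_le_iff]
  norm_num

/-- The product of 1 - x + x²/2 and 1 + x + x²/2 is 1 + x⁴/4, hence at least 1. -/
theorem exp_neg_le_quadratic {x : ℝ} (hx : 0 ≤ x) : Real.exp (-x) ≤ 1 - x + x ^ 2 / 2 := by
  have h := Real.quadratic_le_exp_of_nonneg hx
  rw [Real.exp_neg]
  refine (inv_anti₀ (by positivity) h).trans ?_
  rw [inv_le_iff_one_le_mul₀ (by positivity)]
  nlinarith [sq_nonneg (x ^ 2)]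

/-- A lower tail of a nonnegative variable needs only its first two moments. The level 0.58 stays
below 2/π ≈ 0.637. -/
theorem measureReal_sum_abs_crossForm_le {a : Fin n → Ω → Vec d₁ × Vec d₂}
    (ha : ∀ i, HasLaw (a i) (dataLaw d₁ d₂) μ) (hindep : iIndepFun a μ)
    {xs w : Cat d₁ d₂} (hpos : 0 < crossVar xs w) :
    μ.real {ω | ∑ i, |crossForm xs w (a i ω)| ≤ n * (0.58 * √(crossVar xs w))}
      ≤ Real.exp (-(0.001 * n)) := by
  have hs : 0 < √(crossVar xs w) := Real.sqrt_pos.2 hpos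
  obtain ⟨hsqi, hsq⟩ := integrable_and_integral_crossForm_sq xs w
  have habsi := (integrable_crossForm xs w).abs
  have habs := two_div_pi_mul_sqrt_crossVar_le xs w
  set s := √(crossVar xs w) with hs_def
  have hss : s ^ 2 = crossVar xs w := Real.sq_sqrt hpos.le
  set t : ℝ := 0.05 / s with ht_def
  have ht : 0 ≤ t := by positivity
  have hts : t * s = 0.05 := by rw [ht_def]; field_simp
  have hexpi : Integrable (fun x => Real.exp (t * -|crossForm xs w x|)) (dataLaw d₁ d₂) := by
    refine Integrable.of_bound (C := 1) (by fun_prop) (Filter.Eventually.of_forall fun x => ?_)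
    rw [Real.norm_eq_abs, Real.abs_exp, Real.exp_le_one_iff]
    nlinarith [abs_nonneg (crossForm xs w x)]
  have key := measureReal_le_sum_le_of_integral_exp_le ha hindep
    (g := fun x => -|crossForm xs w x|) (t := t) (κ := -(0.58 * s)) (c := 0.001)
    (by fun_prop) ht hexpi ?_
  · refine le_trans (le_of_eq ?_) key
    congr 1
    ext ω
    simp only [Set.mem_ofPred_eq, Finset.sum_neg_distrib, mul_neg]
    exact neg_le_neg_iff.symm
  · have hq : Integrable (fun x => 1 - t * |crossForm xs w x| + t ^ 2 / 2 * crossForm xs w x ^ 2)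
        (dataLaw d₁ d₂) :=
      ((integrable_const 1).sub (habsi.const_mul t)).add (hsqi.const_mul _)
    have h1 : Integrable (fun x => 1 - t * |crossForm xs w x|) (dataLaw d₁ d₂) :=
      (integrable_const 1).sub (habsi.const_mul t)
    calc ∫ x, Real.exp (t * -|crossForm xs w x|) ∂(dataLaw d₁ d₂)
        ≤ ∫ x, (1 - t * |crossForm xs w x| + t ^ 2 / 2 * crossForm xs w x ^ 2)
          ∂(dataLaw d₁ d₂) := by
          refine integral_mono hexpi hq fun x => ?_
          have := exp_neg_le_quadratic (mul_nonneg ht (abs_nonneg (crossForm xs w x)))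
          rw [mul_pow, sq_abs] at this
          simp only [mul_neg]
          linarith
      _ = 1 - t * (∫ x, |crossForm xs w x| ∂(dataLaw d₁ d₂)) + t ^ 2 / 2 * s ^ 2 := by
          rw [integral_add h1 (hsqi.const_mul _), integral_sub (integrable_const 1)
            (habsi.const_mul t), integral_const_mul, integral_const_mul, hsq, hss]
          simp
      _ ≤ 1 - t * (2 / Real.pi * s) + t ^ 2 / 2 * s ^ 2 := by gcongr
      _ = 1 - 0.05 * (2 / Real.pi) + 0.05 ^ 2 / 2 := by
          rw [← hts]
          ring
      _ ≤ (t * s) * (-0.58) - 0.001 + 1 := by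
          rw [hts]
          have : 0.6349 ≤ 2 / Real.pi := by
            rw [le_div_iff₀ Real.pi_pos]
            linarith [Real.pi_lt_d2]
          linarith
      _ ≤ Real.exp (t * -(0.58 * s) - 0.001) := by
          refine le_trans (Real.add_one_le_exp _) (le_of_eq ?_)
          congr 1
          ring

end Tails

/-! ### Gradients of the quadratics and an upper bound for `lambdaD`. -/

section Gradients

variable {d₁ d₂ : ℕ}

theorem gradient_quarter_inner_sq (c x : Cat d₁ d₂) :
    gradient (fun x => 1 / 4 * |inner ℝ c x| ^ 2) x = (1 / 2 * inner ℝ c x : ℝ) • c := by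
  refine HasGradientAt.gradient ?_
  rw [hasGradientAt_iff_hasFDerivAt]
  have h : HasFDerivAt (fun x => inner ℝ c x) (innerSL ℝ c) x := (innerSL ℝ c).hasFDerivAt
  have h2 := (h.pow 2).const_mul (1 / 4)
  simp_rw [sq_abs]
  convert! h2 using 1
  ext z
  simp [InnerProductSpace.toDual_apply_apply]
  ring

theorem gradient_fPos (a : Vec d₁ × Vec d₂) (x : Cat d₁ d₂) :
    gradient (fPos a) x = (1 / 2 * inner ℝ (concat a.1 a.2) x : ℝ) • concat a.1 a.2 :=
  gradient_quarter_inner_sq _ x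

theorem gradient_fNeg (a : Vec d₁ × Vec d₂) (x : Cat d₁ d₂) :
    gradient (fNeg a) x = (1 / 2 * inner ℝ (concat a.1 (-a.2)) x : ℝ) • concat a.1 (-a.2) :=
  gradient_quarter_inner_sq _ x

theorem inner_concat (u : Vec d₁) (v : Vec d₂) (x : Cat d₁ d₂) :
    inner ℝ (concat u v) x = inner ℝ u x.fst + inner ℝ v x.snd := by
  rw [WithLp.prod_inner_apply]
  rfl

theorem q_eq_abs_crossForm (xs : Cat d₁ d₂) (a : Vec d₁ × Vec d₂) (z : Cat d₁ d₂) :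
    q xs a z = 1 / 2 * |crossForm xs z a| := by
  rw [q, gradient_fPos, gradient_fNeg]
  congr 2
  simp only [inner_sub_left, inner_smul_left, inner_concat, crossForm, inner_neg_left]
  simp
  ring

theorem inner_gradient_add (xs : Cat d₁ d₂) (a : Vec d₁ × Vec d₂) (z : Cat d₁ d₂) :
    inner ℝ (gradient (fPos a) xs + gradient (fNeg a) xs) z
      = inner ℝ a.1 xs.fst * inner ℝ a.1 z.fst + inner ℝ a.2 xs.snd * inner ℝ a.2 z.snd := by
  rw [gradient_fPos, gradient_fNeg]
  simp only [inner_add_left, inner_smul_left, inner_concat, inner_neg_left]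
  simp
  ring

theorem norm_sq_eq_add (x : Cat d₁ d₂) : ‖x‖ ^ 2 = ‖x.fst‖ ^ 2 + ‖x.snd‖ ^ 2 := by
  rw [WithLp.prod_norm_sq_eq_of_L2]

theorem integral_abs_crossForm_self (xs : Cat d₁ d₂) :
    ∫ a, |crossForm xs xs a| ∂(dataLaw d₁ d₂) = 4 / Real.pi * (‖xs.fst‖ * ‖xs.snd‖) := by
  have h : ∀ a : Vec d₁ × Vec d₂, |crossForm xs xs a|
      = 2 * (|inner ℝ a.1 xs.fst| * |inner ℝ a.2 xs.snd|) := by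
    intro a
    rw [← abs_mul, show crossForm xs xs a = 2 * (inner ℝ a.1 xs.fst * inner ℝ a.2 xs.snd) by
      unfold crossForm; ring, abs_mul, abs_two]
  simp_rw [h]
  unfold dataLaw
  rw [integral_const_mul, integral_prod_mul (fun x : Vec d₁ => |inner ℝ x xs.fst|)
    (fun y : Vec d₂ => |inner ℝ y xs.snd|), integral_abs_inner_stdGaussian,
    integral_abs_inner_stdGaussian]
  have hp : √(2 / Real.pi) * √(2 / Real.pi) = 2 / Real.pi := Real.mul_self_sqrt (by positivity)
  linear_combination (2 * ‖xs.fst‖ * ‖xs.snd‖) * hp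

/-- The normalized ground truth is an admissible test vector, because balance makes `xs` orthogonal
to `flip xs`. There the integral factors and equals √2/π ≈ 0.4502 times the block norm. -/
theorem lambdaD_le {xs : Cat d₁ d₂} (h0 : xs.fst ≠ 0) (hbal : ‖xs.fst‖ = ‖xs.snd‖) :
    lambdaD xs ≤ 0.451 * ‖xs.fst‖ := by
  have hr : 0 < ‖xs.fst‖ := norm_pos_iff.2 h0
  have hnorm : ‖xs‖ = √2 * ‖xs.fst‖ := by
    rw [← Real.sqrt_sq (norm_nonneg xs), norm_sq_eq_add, ← hbal, ← two_mul,
      Real.sqrt_mul (by norm_num), Real.sqrt_sq hr.le]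
  have hxs : 0 < ‖xs‖ := by rw [hnorm]; positivity
  have hflip : inner ℝ xs (flip xs) = (0 : ℝ) := by
    rw [real_inner_comm, flip, inner_concat, inner_neg_left, real_inner_self_eq_norm_sq,
      real_inner_self_eq_norm_sq, hbal]
    ring
  have hz : ‖xs‖⁻¹ • xs ∈ restrictionSet xs := by
    refine ⟨by rw [norm_smul, norm_inv, norm_norm, inv_mul_cancel₀ hxs.ne'], ?_⟩
    rw [inner_smul_left, hflip, mul_zero, abs_zero]
    positivity
  have hle : lambdaD xs ≤ ∫ a, q xs a (‖xs‖⁻¹ • xs) ∂(dataLaw d₁ d₂) := by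
    refine ciInf_le (f := fun z : restrictionSet xs => ∫ a, q xs a z ∂(dataLaw d₁ d₂))
      ⟨0, ?_⟩ ⟨_, hz⟩
    rintro _ ⟨z, rfl⟩
    exact integral_nonneg fun a => by unfold q; positivity
  have hq : ∀ a : Vec d₁ × Vec d₂, q xs a (‖xs‖⁻¹ • xs)
      = 1 / 2 * ‖xs‖⁻¹ * |crossForm xs xs a| := by
    intro a
    rw [q_eq_abs_crossForm, mul_assoc, show crossForm xs (‖xs‖⁻¹ • xs) a
      = ‖xs‖⁻¹ * crossForm xs xs a by
        simp only [crossForm, WithLp.smul_fst, WithLp.smul_snd, inner_smul_right]; ring,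
      abs_mul, abs_inv, abs_norm]
  simp_rw [hq] at hle
  rw [integral_const_mul, integral_abs_crossForm_self, ← hbal, hnorm] at hle
  refine hle.trans ?_
  have h2 : √2 * √2 = (2 : ℝ) := Real.mul_self_sqrt (by norm_num)
  have hs2 : √2 ≤ 1.415 := by rw [Real.sqrt_le_iff]; norm_num
  have hs0 : 0 < √2 := by positivity
  have hpi := Real.pi_pos
  have heq : 1 / 2 * (√2 * ‖xs.fst‖)⁻¹ * (4 / Real.pi * (‖xs.fst‖ * ‖xs.fst‖))
      = √2 / Real.pi * ‖xs.fst‖ := by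
    field_simp
    linarith
  rw [heq]
  gcongr
  rw [div_le_iff₀ hpi]
  nlinarith [Real.pi_gt_d2]

end Gradients

/-! ### From nets to estimates uniform in the direction. -/

section Uniform

theorem mul_opNorm_le_of_net {E F : Type*} [NormedAddCommGroup E] [NormedSpace ℝ E]
    [NormedAddCommGroup F] [NormedSpace ℝ F] (T : E →L[ℝ] F) {N : Finset E} {η K : ℝ}
    (hη : 0 ≤ η) (hK : 0 ≤ K) (hN : ∀ x : E, ‖x‖ = 1 → ∃ y ∈ N, ‖x - y‖ < η)
    (hT : ∀ y ∈ N, ‖T y‖ ≤ K) : (1 - η) * ‖T‖ ≤ K := by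
  have h : ‖T‖ ≤ K + η * ‖T‖ := by
    refine ContinuousLinearMap.opNorm_le_of_unit_norm (by positivity) fun x hx => ?_
    obtain ⟨y, hy, hxy⟩ := hN x hx
    calc ‖T x‖ = ‖T y + T (x - y)‖ := by rw [← map_add]; congr 2; abel
      _ ≤ ‖T y‖ + ‖T (x - y)‖ := norm_add_le _ _
      _ ≤ K + ‖T‖ * ‖x - y‖ := add_le_add (hT y hy) (T.le_opNorm _)
      _ ≤ K + η * ‖T‖ := by rw [mul_comm]; gcongr
  linarith

theorem sum_inner_sq_le_of_net {d n : ℕ} (a : Fin n → Vec d) {N : Finset (Vec d)}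
    (hN : ∀ x : Vec d, ‖x‖ = 1 → ∃ y ∈ N, ‖x - y‖ < 0.01)
    (ha : ∀ y ∈ N, ∑ i, (inner ℝ (a i) y) ^ 2 ≤ n * 1.9) (w : Vec d) :
    ∑ i, (inner ℝ (a i) w) ^ 2 ≤ n * (2 * ‖w‖ ^ 2) := by
  let T : Vec d →L[ℝ] EuclideanSpace ℝ (Fin n) :=
    (EuclideanSpace.equiv (Fin n) ℝ).symm.toContinuousLinearMap ∘L
      ContinuousLinearMap.pi fun i => innerSL ℝ (a i)
  have hT : ∀ w, ‖T w‖ ^ 2 = ∑ i, (inner ℝ (a i) w) ^ 2 := fun w => by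
    rw [EuclideanSpace.real_norm_sq_eq]
    rfl
  have h := mul_opNorm_le_of_net T (η := 0.01) (K := √(n * 1.9)) (by norm_num) (by positivity) hN
    fun y hy => Real.le_sqrt_of_sq_le ((hT y).trans_le (ha y hy))
  have h2 : (0.99 * ‖T‖) ^ 2 ≤ n * 1.9 := by
    rw [← Real.sq_sqrt (show (0 : ℝ) ≤ n * 1.9 by positivity)]
    have : 0.99 * ‖T‖ ≤ √(n * 1.9) := by linarith
    gcongr
  have h3 : ‖T‖ ^ 2 ≤ n * 2 := by
    have : (0 : ℝ) ≤ n := by positivity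
    nlinarith
  rw [← hT]
  calc ‖T w‖ ^ 2 ≤ (‖T‖ * ‖w‖) ^ 2 := by gcongr; exact T.le_opNorm w
    _ = ‖T‖ ^ 2 * ‖w‖ ^ 2 := by ring
    _ ≤ n * 2 * ‖w‖ ^ 2 := by gcongr
    _ = _ := by ring

variable {d₁ d₂ n : ℕ}

/-- The deterministic properties of a sample on which exact recovery rests. -/
structure RegularSample (xs : Cat d₁ d₂) (a : Fin n → Vec d₁ × Vec d₂) : Prop where
  upper_fst : ∀ w, ∑ i, (inner ℝ (a i).1 w) ^ 2 ≤ n * (2 * ‖w‖ ^ 2)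
  upper_snd : ∀ w, ∑ i, (inner ℝ (a i).2 w) ^ 2 ≤ n * (2 * ‖w‖ ^ 2)
  lower : ∀ w, inner ℝ w (flip xs) = (0 : ℝ) →
    n * (0.55 * ‖xs.fst‖ * ‖w‖) ≤ ∑ i, |crossForm xs w (a i)|
  lower_self : n * (1.16 * ‖xs.fst‖ ^ 2) ≤ ∑ i, |crossForm xs xs (a i)|

theorem sum_abs_inner_mul_inner_le {d d' : ℕ} {a : Fin n → Vec d} {b : Fin n → Vec d'}
    (ha : ∀ w, ∑ i, (inner ℝ (a i) w) ^ 2 ≤ n * (2 * ‖w‖ ^ 2))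
    (hb : ∀ w, ∑ i, (inner ℝ (b i) w) ^ 2 ≤ n * (2 * ‖w‖ ^ 2)) (u : Vec d) (v : Vec d') :
    ∑ i, |inner ℝ (a i) u * inner ℝ (b i) v| ≤ n * (2 * ‖u‖ * ‖v‖) := by
  have h1 : √(∑ i, |inner ℝ (a i) u| ^ 2) ≤ √(n * (2 * ‖u‖ ^ 2)) := by
    simp_rw [sq_abs]
    exact Real.sqrt_le_sqrt (ha u)
  have h2 : √(∑ i, |inner ℝ (b i) v| ^ 2) ≤ √(n * (2 * ‖v‖ ^ 2)) := by
    simp_rw [sq_abs]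
    exact Real.sqrt_le_sqrt (hb v)
  calc ∑ i, |inner ℝ (a i) u * inner ℝ (b i) v|
      = ∑ i, |inner ℝ (a i) u| * |inner ℝ (b i) v| := by simp_rw [abs_mul]
    _ ≤ √(∑ i, |inner ℝ (a i) u| ^ 2) * √(∑ i, |inner ℝ (b i) v| ^ 2) :=
        Real.sum_mul_le_sqrt_mul_sqrt _ _ _
    _ ≤ √(n * (2 * ‖u‖ ^ 2)) * √(n * (2 * ‖v‖ ^ 2)) := by gcongr
    _ = √((n * (2 * ‖u‖ * ‖v‖)) ^ 2) := by
        rw [← Real.sqrt_mul (by positivity)]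
        congr 1
        ring
    _ = n * (2 * ‖u‖ * ‖v‖) := Real.sqrt_sq (by positivity)

theorem norm_fst_add_norm_snd_le (x : Cat d₁ d₂) : ‖x.fst‖ + ‖x.snd‖ ≤ 1.415 * ‖x‖ := by
  refine abs_le_of_sq_le_sq' ?_ (by positivity) |>.2
  rw [mul_pow, norm_sq_eq_add]
  nlinarith [sq_nonneg (‖x.fst‖ - ‖x.snd‖), sq_nonneg ‖x.fst‖, sq_nonneg ‖x.snd‖]

/-- A Lipschitz bound in the direction `z`, used to pass from the net to the whole sphere. -/
theorem sum_abs_crossForm_le {xs : Cat d₁ d₂} (hbal : ‖xs.fst‖ = ‖xs.snd‖)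
    {a : Fin n → Vec d₁ × Vec d₂}
    (h₁ : ∀ w, ∑ i, (inner ℝ (a i).1 w) ^ 2 ≤ n * (2 * ‖w‖ ^ 2))
    (h₂ : ∀ w, ∑ i, (inner ℝ (a i).2 w) ^ 2 ≤ n * (2 * ‖w‖ ^ 2)) (z : Cat d₁ d₂) :
    ∑ i, |crossForm xs z (a i)| ≤ n * (2.83 * ‖xs.fst‖ * ‖z‖) := by
  calc ∑ i, |crossForm xs z (a i)|
      ≤ ∑ i, (|inner ℝ (a i).2 xs.snd * inner ℝ (a i).1 z.fst|
        + |inner ℝ (a i).1 xs.fst * inner ℝ (a i).2 z.snd|) :=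
        Finset.sum_le_sum fun i _ => abs_add_le _ _
    _ ≤ n * (2 * ‖xs.snd‖ * ‖z.fst‖) + n * (2 * ‖xs.fst‖ * ‖z.snd‖) := by
        rw [Finset.sum_add_distrib]
        exact add_le_add (sum_abs_inner_mul_inner_le h₂ h₁ _ _)
          (sum_abs_inner_mul_inner_le h₁ h₂ _ _)
    _ = n * (2 * ‖xs.fst‖ * (‖z.fst‖ + ‖z.snd‖)) := by rw [← hbal]; ring
    _ ≤ n * (2 * ‖xs.fst‖ * (1.415 * ‖z‖)) := by
        gcongr
        exact norm_fst_add_norm_snd_le z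
    _ = _ := by ring

theorem inner_flip (w xs : Cat d₁ d₂) :
    inner ℝ w (flip xs) = inner ℝ xs.fst w.fst - inner ℝ xs.snd w.snd := by
  rw [real_inner_comm, flip, inner_concat, inner_neg_left]
  ring

/-- Orthogonality to `flip xs` makes the two inner products in the cross term equal, so that term is
twice a square and can be dropped. -/
theorem sq_mul_sq_le_crossVar {xs w : Cat d₁ d₂} (hbal : ‖xs.fst‖ = ‖xs.snd‖)
    (hw : inner ℝ w (flip xs) = (0 : ℝ)) : (‖xs.fst‖ * ‖w‖) ^ 2 ≤ crossVar xs w := by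
  rw [inner_flip] at hw
  have h : inner ℝ xs.fst w.fst = inner ℝ xs.snd w.snd := by linarith
  rw [crossVar, mul_pow, norm_sq_eq_add w, h, ← hbal]
  nlinarith [sq_nonneg (inner ℝ xs.snd w.snd)]

theorem crossVar_self {xs : Cat d₁ d₂} (hbal : ‖xs.fst‖ = ‖xs.snd‖) :
    crossVar xs xs = (2 * ‖xs.fst‖ ^ 2) ^ 2 := by
  rw [crossVar, real_inner_self_eq_norm_sq, real_inner_self_eq_norm_sq, ← hbal]
  ring

/-- The net resolution 0.01 costs 1.9/0.99² ≤ 2 in the upper bounds and 0.58 - 0.0283 ≥ 0.55 in the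
lower one. -/
theorem regularSample_of_net {xs : Cat d₁ d₂} (hbal : ‖xs.fst‖ = ‖xs.snd‖)
    {a : Fin n → Vec d₁ × Vec d₂} {N₁ : Finset (Vec d₁)} {N₂ : Finset (Vec d₂)}
    {N : Finset (Cat d₁ d₂)}
    (hN₁ : ∀ x : Vec d₁, ‖x‖ = 1 → ∃ y ∈ N₁, ‖x - y‖ < 0.01)
    (hN₂ : ∀ x : Vec d₂, ‖x‖ = 1 → ∃ y ∈ N₂, ‖x - y‖ < 0.01)
    (hNS : ∀ y ∈ N, ‖y‖ = 1 ∧ inner ℝ y (flip xs) = (0 : ℝ))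
    (hN : ∀ x : Cat d₁ d₂, ‖x‖ = 1 → inner ℝ x (flip xs) = (0 : ℝ) → ∃ y ∈ N, ‖x - y‖ < 0.01)
    (h₁ : ∀ y ∈ N₁, ∑ i, (inner ℝ (a i).1 y) ^ 2 ≤ n * 1.9)
    (h₂ : ∀ y ∈ N₂, ∑ i, (inner ℝ (a i).2 y) ^ 2 ≤ n * 1.9)
    (h : ∀ y ∈ N, n * (0.58 * √(crossVar xs y)) ≤ ∑ i, |crossForm xs y (a i)|)
    (hs : n * (0.58 * √(crossVar xs xs)) ≤ ∑ i, |crossForm xs xs (a i)|) :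
    RegularSample xs a := by
  have hu₁ := sum_inner_sq_le_of_net (fun i => (a i).1) hN₁ h₁
  have hu₂ := sum_inner_sq_le_of_net (fun i => (a i).2) hN₂ h₂
  refine ⟨hu₁, hu₂, fun w hw => ?_, ?_⟩
  · have hunit : ∀ x : Cat d₁ d₂, ‖x‖ = 1 → inner ℝ x (flip xs) = (0 : ℝ) →
        n * (0.55 * ‖xs.fst‖) ≤ ∑ i, |crossForm xs x (a i)| := by
      intro x hx hxs
      obtain ⟨y, hy, hxy⟩ := hN x hx hxs
      have hvar : ‖xs.fst‖ ≤ √(crossVar xs y) := by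
        have := sq_mul_sq_le_crossVar hbal (hNS y hy).2
        rw [(hNS y hy).1, mul_one] at this
        exact Real.le_sqrt_of_sq_le this
      have hdiff : ∑ i, |crossForm xs (x - y) (a i)| ≤ n * (0.0283 * ‖xs.fst‖) := by
        refine (sum_abs_crossForm_le hbal hu₁ hu₂ (x - y)).trans ?_
        calc (n : ℝ) * (2.83 * ‖xs.fst‖ * ‖x - y‖) ≤ n * (2.83 * ‖xs.fst‖ * 0.01) := by gcongr
          _ = _ := by ring
      have htri : ∑ i, |crossForm xs y (a i)|
          ≤ ∑ i, |crossForm xs x (a i)| + ∑ i, |crossForm xs (x - y) (a i)| := by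
        rw [← Finset.sum_add_distrib]
        refine Finset.sum_le_sum fun i _ => ?_
        rw [show crossForm xs y (a i) = crossForm xs x (a i) - crossForm xs (x - y) (a i) by
          simp only [crossForm, WithLp.sub_fst, WithLp.sub_snd, inner_sub_right]; ring]
        exact abs_sub _ _
      have hy' : (n : ℝ) * (0.58 * ‖xs.fst‖) ≤ n * (0.58 * √(crossVar xs y)) := by gcongr
      have hpos : 0 ≤ (n : ℝ) * ‖xs.fst‖ := by positivity
      linarith [h y hy]
    by_cases hw0 : w = 0
    · rw [hw0, norm_zero, mul_zero, mul_zero]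
      positivity
    have hwn : 0 < ‖w‖ := norm_pos_iff.2 hw0
    have hx := hunit (‖w‖⁻¹ • w) (by rw [norm_smul, norm_inv, norm_norm, inv_mul_cancel₀ hwn.ne'])
      (by rw [inner_smul_left, hw, mul_zero])
    have hc : ∀ i, |crossForm xs (‖w‖⁻¹ • w) (a i)| = ‖w‖⁻¹ * |crossForm xs w (a i)| := by
      intro i
      rw [show crossForm xs (‖w‖⁻¹ • w) (a i) = ‖w‖⁻¹ * crossForm xs w (a i) by
        simp only [crossForm, WithLp.smul_fst, WithLp.smul_snd, inner_smul_right]; ring,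
        abs_mul, abs_inv, abs_norm]
    simp_rw [hc] at hx
    rw [← Finset.mul_sum, inv_mul_eq_div, le_div_iff₀ hwn] at hx
    linarith
  · rw [crossVar_self hbal, Real.sqrt_sq (by positivity)] at hs
    linarith

theorem finrank_cat : Module.finrank ℝ (Cat d₁ d₂) = d₁ + d₂ := by
  rw [(WithLp.linearEquiv 2 ℝ (Vec d₁ × Vec d₂)).finrank_eq]
  simp

variable {Ω : Type*} [MeasurableSpace Ω] {μ : Measure Ω} [IsProbabilityMeasure μ]

/-- A union bound over three nets, each of at most 201^(d₁+d₂) points since 1 + 2/0.01 = 201, and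
the single direction `xs`: hence the factor 4. -/
theorem measureReal_not_regularSample_le {xs : Cat d₁ d₂} (h0 : xs.fst ≠ 0)
    (hbal : ‖xs.fst‖ = ‖xs.snd‖) {a : Fin n → Ω → Vec d₁ × Vec d₂}
    (ha : ∀ i, HasLaw (a i) (dataLaw d₁ d₂) μ) (hindep : iIndepFun a μ) :
    μ.real {ω | ¬ RegularSample xs fun i => a i ω}
      ≤ 4 * 201 ^ (d₁ + d₂) * Real.exp (-(0.001 * n)) := by
  have hr : 0 < ‖xs.fst‖ := norm_pos_iff.2 h0
  have hfst : HasLaw Prod.fst (stdGaussian (Vec d₁)) (dataLaw d₁ d₂) :=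
    measurePreserving_fst.hasLaw
  have hsnd : HasLaw Prod.snd (stdGaussian (Vec d₂)) (dataLaw d₁ d₂) :=
    measurePreserving_snd.hasLaw
  obtain ⟨N₁, hNS₁, hc₁, hN₁⟩ := exists_net (η := 0.01) (by norm_num) {x : Vec d₁ | ‖x‖ = 1}
    fun c hc => le_of_eq hc
  obtain ⟨N₂, hNS₂, hc₂, hN₂⟩ := exists_net (η := 0.01) (by norm_num) {x : Vec d₂ | ‖x‖ = 1}
    fun c hc => le_of_eq hc
  obtain ⟨N, hNS, hc, hN⟩ := exists_net (η := 0.01) (by norm_num)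
    {x : Cat d₁ d₂ | ‖x‖ = 1 ∧ inner ℝ x (flip xs) = (0 : ℝ)} fun c hc => le_of_eq hc.1
  norm_num at hc₁ hc₂ hc
  rw [finrank_cat] at hc
  set B₁ : Vec d₁ → Set Ω := fun y => {ω | (n : ℝ) * 1.9 ≤ ∑ i, (inner ℝ (a i ω).1 y) ^ 2}
  set B₂ : Vec d₂ → Set Ω := fun y => {ω | (n : ℝ) * 1.9 ≤ ∑ i, (inner ℝ (a i ω).2 y) ^ 2}
  set B : Cat d₁ d₂ → Set Ω := fun y =>
    {ω | ∑ i, |crossForm xs y (a i ω)| ≤ n * (0.58 * √(crossVar xs y))}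
  have hB₁ : ∀ y ∈ N₁, μ.real (B₁ y) ≤ Real.exp (-(0.001 * n)) := fun y hy =>
    measureReal_le_sum_inner_sq (a := fun i ω => (a i ω).1) (fun i => hfst.comp (ha i))
      (hindep.comp (fun _ => Prod.fst) fun _ => measurable_fst) (hNS₁ hy)
  have hB₂ : ∀ y ∈ N₂, μ.real (B₂ y) ≤ Real.exp (-(0.001 * n)) := fun y hy =>
    measureReal_le_sum_inner_sq (a := fun i ω => (a i ω).2) (fun i => hsnd.comp (ha i))
      (hindep.comp (fun _ => Prod.snd) fun _ => measurable_snd) (hNS₂ hy)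
  have hB : ∀ y ∈ N, μ.real (B y) ≤ Real.exp (-(0.001 * n)) := fun y hy => by
    refine measureReal_sum_abs_crossForm_le ha hindep ?_
    refine lt_of_lt_of_le ?_ (sq_mul_sq_le_crossVar hbal (hNS hy).2)
    rw [(hNS hy).1]
    positivity
  have hBs : μ.real (B xs) ≤ Real.exp (-(0.001 * n)) := by
    refine measureReal_sum_abs_crossForm_le ha hindep ?_
    rw [crossVar_self hbal]
    positivity
  have hsub : {ω | ¬ RegularSample xs fun i => a i ω}
      ⊆ ((⋃ y ∈ N₁, B₁ y) ∪ (⋃ y ∈ N₂, B₂ y)) ∪ ((⋃ y ∈ N, B y) ∪ B xs) := by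
    intro ω hω
    by_contra hcon
    simp only [Set.mem_union, Set.mem_iUnion, not_or, not_exists] at hcon
    obtain ⟨⟨g₁, g₂⟩, g, gs⟩ := hcon
    exact hω (regularSample_of_net hbal hN₁ hN₂ (fun y hy => hNS hy)
      (fun x hx hxs => hN x ⟨hx, hxs⟩) (fun y hy => (not_le.1 (g₁ y hy)).le)
      (fun y hy => (not_le.1 (g₂ y hy)).le) (fun y hy => (not_le.1 (g y hy)).le)
      (not_le.1 gs).le)
  have hunion : ∀ {X : Type} (M : Finset X) (A : X → Set Ω),
      (∀ y ∈ M, μ.real (A y) ≤ Real.exp (-(0.001 * n))) →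
      μ.real (⋃ y ∈ M, A y) ≤ M.card * Real.exp (-(0.001 * n)) := by
    intro X M A hA
    refine (measureReal_biUnion_finset_le M A).trans ?_
    rw [← nsmul_eq_mul]
    exact Finset.sum_le_card_nsmul _ _ _ hA
  have hp₁ : (201 : ℝ) ^ d₁ ≤ 201 ^ (d₁ + d₂) := pow_le_pow_right₀ (by norm_num) (by omega)
  have hp₂ : (201 : ℝ) ^ d₂ ≤ 201 ^ (d₁ + d₂) := pow_le_pow_right₀ (by norm_num) (by omega)
  have hp₀ : (1 : ℝ) ≤ 201 ^ (d₁ + d₂) := one_le_pow₀ (by norm_num)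
  calc μ.real {ω | ¬ RegularSample xs fun i => a i ω}
      ≤ μ.real (((⋃ y ∈ N₁, B₁ y) ∪ (⋃ y ∈ N₂, B₂ y)) ∪ ((⋃ y ∈ N, B y) ∪ B xs)) :=
        measureReal_mono hsub
    _ ≤ (μ.real (⋃ y ∈ N₁, B₁ y) + μ.real (⋃ y ∈ N₂, B₂ y))
        + (μ.real (⋃ y ∈ N, B y) + μ.real (B xs)) :=
        (measureReal_union_le _ _).trans
          (add_le_add (measureReal_union_le _ _) (measureReal_union_le _ _))
    _ ≤ (N₁.card * Real.exp (-(0.001 * n)) + N₂.card * Real.exp (-(0.001 * n)))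
        + (N.card * Real.exp (-(0.001 * n)) + Real.exp (-(0.001 * n))) :=
        add_le_add (add_le_add (hunion N₁ B₁ hB₁) (hunion N₂ B₂ hB₂))
          (add_le_add (hunion N B hB) hBs)
    _ = (N₁.card + N₂.card + (N.card + 1)) * Real.exp (-(0.001 * n)) := by ring
    _ ≤ 4 * 201 ^ (d₁ + d₂) * Real.exp (-(0.001 * n)) := by
        gcongr
        linarith

/-- Since 201 ≤ e⁶, half of the exponent 0.001 n absorbs the nets and the rest absorbs log(8/δ).
This leaves 4·δ/8. -/
theorem failure_probability_le {d : ℕ} {ε δ : ℝ} (hε : 7 / 8 ≤ ε) (hε1 : ε < 1) (hδ : 0 < δ)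
    (hn : 12000 * ε ^ (-4 : ℤ) * max (d : ℝ) (Real.log (8 / δ)) ≤ (n : ℝ)) :
    4 * 201 ^ d * Real.exp (-(0.001 * n)) ≤ δ := by
  have hε4 : 1 ≤ ε ^ (-4 : ℤ) := by
    rw [zpow_neg]
    refine (one_le_inv₀ (by positivity)).2 ?_
    exact_mod_cast pow_le_one₀ (n := 4) (by linarith) hε1.le
  have hmax : 0 ≤ max (d : ℝ) (Real.log (8 / δ)) := le_max_of_le_left (by positivity)
  have hn' : 12000 * max (d : ℝ) (Real.log (8 / δ)) ≤ n := by
    refine le_trans ?_ hn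
    gcongr
    linarith
  have hd : 12000 * (d : ℝ) ≤ n := le_trans (by gcongr; exact le_max_left _ _) hn'
  have hlog : 12000 * Real.log (8 / δ) ≤ n := le_trans (by gcongr; exact le_max_right _ _) hn'
  have h201 : (201 : ℝ) ≤ Real.exp 6 := by
    have h1 := Real.exp_one_gt_d9
    have : Real.exp 6 = Real.exp 1 ^ 6 := by rw [← Real.exp_nat_mul]; norm_num
    rw [this]
    calc (201 : ℝ) ≤ 2.7 ^ 6 := by norm_num
      _ ≤ _ := by gcongr; linarith
  calc 4 * 201 ^ d * Real.exp (-(0.001 * n))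
      ≤ 4 * Real.exp 6 ^ d * Real.exp (-(0.001 * n)) := by gcongr
    _ = 4 * Real.exp (6 * d - 0.001 * n) := by
        rw [← Real.exp_nat_mul, mul_assoc, ← Real.exp_add]
        ring_nf
    _ ≤ 4 * Real.exp (-Real.log (8 / δ)) := by
        gcongr
        have : (0 : ℝ) ≤ n := by positivity
        linarith
    _ = δ / 2 := by
        rw [Real.exp_neg, Real.exp_log (by positivity)]
        field_simp
        norm_num
    _ ≤ δ := by linarith

end Uniform

/-! ### Deterministic recovery from a regular sample. -/

section Recovery

variable {d₁ d₂ n : ℕ}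

/-- The reciprocal rescaling of `xs` by `t`. -/
noncomputable def rescale (xs : Cat d₁ d₂) (t : ℝ) : Cat d₁ d₂ :=
  concat (t • xs.fst) (t⁻¹ • xs.snd)

/-- The directional derivative along `z`, at `rescale xs t`, of the objective with each maximum
replaced by the mean of its two arguments. -/
noncomputable def anchorGap (xs : Cat d₁ d₂) (a : Fin n → Vec d₁ × Vec d₂) (a₀ : Cat d₁ d₂)
    (t : ℝ) (z : Cat d₁ d₂) : ℝ :=
  inner ℝ a₀ z - 1 / (n : ℝ) * ∑ i, 1 / 2 * (t * inner ℝ (a i).1 xs.fst * inner ℝ (a i).1 z.fst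
    + t⁻¹ * inner ℝ (a i).2 xs.snd * inner ℝ (a i).2 z.snd)

theorem inner_eq_inner_fst_add (x y : Cat d₁ d₂) :
    inner ℝ x y = (inner ℝ x.fst y.fst + inner ℝ x.snd y.snd : ℝ) :=
  WithLp.prod_inner_apply _ _

theorem anchorGap_add (xs : Cat d₁ d₂) (a : Fin n → Vec d₁ × Vec d₂) (a₀ : Cat d₁ d₂)
    (t : ℝ) (z z' : Cat d₁ d₂) :
    anchorGap xs a a₀ t (z + z') = anchorGap xs a a₀ t z + anchorGap xs a a₀ t z' := by
  simp only [anchorGap, WithLp.add_fst, WithLp.add_snd, inner_add_right, Finset.mul_sum]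
  rw [sub_add_sub_comm, ← Finset.sum_add_distrib]
  congr 1
  exact Finset.sum_congr rfl fun i _ => by ring

theorem anchorGap_smul (xs : Cat d₁ d₂) (a : Fin n → Vec d₁ × Vec d₂) (a₀ : Cat d₁ d₂)
    (t s : ℝ) (z : Cat d₁ d₂) :
    anchorGap xs a a₀ t (s • z) = s * anchorGap xs a a₀ t z := by
  simp only [anchorGap, WithLp.smul_fst, WithLp.smul_snd, inner_smul_right, Finset.mul_sum,
    mul_sub]
  congr 1
  exact Finset.sum_congr rfl fun i _ => by ring

/-- Separates the oracle error from the effect of `t` differing from 1. -/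
theorem anchorGap_eq (xs : Cat d₁ d₂) (a : Fin n → Vec d₁ × Vec d₂) (a₀ : Cat d₁ d₂)
    (t : ℝ) (z : Cat d₁ d₂) :
    anchorGap xs a a₀ t z = inner ℝ (a₀ - (1 / (2 * (n : ℝ))) •
        ∑ i, (gradient (fPos (a i)) xs + gradient (fNeg (a i)) xs)) z
      + 1 / (2 * n) * ((1 - t) * ∑ i, inner ℝ (a i).1 xs.fst * inner ℝ (a i).1 z.fst
        + (1 - t⁻¹) * ∑ i, inner ℝ (a i).2 xs.snd * inner ℝ (a i).2 z.snd) := by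
  rw [inner_sub_left, inner_smul_left, sum_inner]
  simp_rw [inner_gradient_add]
  simp only [anchorGap, conj_trivial, mul_add, mul_assoc, ← Finset.mul_sum,
    Finset.sum_add_distrib]
  ring

/-- At a rescaling the two arguments of each maximum agree, so the maximum can be taken over
increments alone. Their common linear part goes into `anchorGap`; `c i` is any lower bound for what
is left. -/
theorem objective_rescale_add_sub_le (xs : Cat d₁ d₂) (a : Fin n → Vec d₁ × Vec d₂)
    (a₀ z : Cat d₁ d₂) {t : ℝ} (ht : t ≠ 0) {c : Fin n → ℝ}
    (hc : ∀ i, c i ≤ max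
      (1 / 4 * (inner ℝ (a i).1 z.fst + inner ℝ (a i).2 z.snd) ^ 2
        + 1 / 2 * (t * inner ℝ (a i).1 xs.fst * inner ℝ (a i).2 z.snd
          + t⁻¹ * inner ℝ (a i).2 xs.snd * inner ℝ (a i).1 z.fst))
      (1 / 4 * (inner ℝ (a i).1 z.fst - inner ℝ (a i).2 z.snd) ^ 2
        - 1 / 2 * (t * inner ℝ (a i).1 xs.fst * inner ℝ (a i).2 z.snd
          + t⁻¹ * inner ℝ (a i).2 xs.snd * inner ℝ (a i).1 z.fst))) :
    objective a (fun i => measurement xs (a i)) a₀ (rescale xs t + z)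
      - objective a (fun i => measurement xs (a i)) a₀ (rescale xs t)
      ≤ anchorGap xs a a₀ t z - 1 / n * ∑ i, c i := by
  have hpt : ∀ i, max (fPos (a i) (rescale xs t) - measurement xs (a i))
        (fNeg (a i) (rescale xs t))
      + 1 / 2 * (t * inner ℝ (a i).1 xs.fst * inner ℝ (a i).1 z.fst
        + t⁻¹ * inner ℝ (a i).2 xs.snd * inner ℝ (a i).2 z.snd) + c i
      ≤ max (fPos (a i) (rescale xs t + z) - measurement xs (a i))
        (fNeg (a i) (rescale xs t + z)) := by
    intro i
    have hf1 : (rescale xs t).fst = t • xs.fst := rfl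
    have hf2 : (rescale xs t).snd = t⁻¹ • xs.snd := rfl
    have htt : t * t⁻¹ = 1 := mul_inv_cancel₀ ht
    have hci := hc i
    simp only [fPos, fNeg, measurement, inner_concat,
      inner_add_right, inner_neg_left, hf1, hf2, inner_smul_right, sq_abs,
      real_inner_comm (a i).2 xs.snd]
    generalize inner ℝ (a i).1 xs.fst = α at hci ⊢
    generalize inner ℝ (a i).2 xs.snd = β at hci ⊢
    generalize inner ℝ (a i).1 z.fst = p at hci ⊢
    generalize inner ℝ (a i).2 z.snd = q at hci ⊢
    have h1 : 1 / 4 * (t * α + t⁻¹ * β) ^ 2 - α * β = 1 / 4 * (t * α + t⁻¹ * -β) ^ 2 := by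
      linear_combination (α * β) * htt
    rw [h1, max_self]
    rcases le_max_iff.1 hci with h | h
    · refine le_trans ?_ (le_max_left _ _)
      linear_combination h - (α * β) * htt
    · refine le_trans ?_ (le_max_right _ _)
      linear_combination h
  have hsum := Finset.sum_le_sum fun i (_ : i ∈ Finset.univ) => hpt i
  rw [Finset.sum_add_distrib, Finset.sum_add_distrib] at hsum
  have hn : (0 : ℝ) ≤ 1 / n := by positivity
  have hmul := mul_le_mul_of_nonneg_left hsum hn
  simp only [objective, anchorGap, inner_add_right]
  linarith

/-- Stationarity along the curve of rescalings is one scalar equation in `t`; the oracle error is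
too small to prevent a change of sign on [0.9, 1.1]. -/
theorem exists_anchorGap_flip_rescale_eq_zero {xs : Cat d₁ d₂} (h0 : xs.fst ≠ 0)
    (hbal : ‖xs.fst‖ = ‖xs.snd‖) (hn : 0 < n) {a : Fin n → Vec d₁ × Vec d₂}
    (hreg : RegularSample xs a) {a₀ : Cat d₁ d₂}
    (he : ‖a₀ - (1 / (2 * (n : ℝ))) •
      ∑ i, (gradient (fPos (a i)) xs + gradient (fNeg (a i)) xs)‖ ≤ 0.0282 * ‖xs.fst‖) :
    ∃ t ∈ Set.Icc (0.9 : ℝ) 1.1, anchorGap xs a a₀ t (flip (rescale xs t)) = 0 := by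
  have hr : 0 < ‖xs.fst‖ := norm_pos_iff.2 h0
  have hn0 : (0 : ℝ) < n := by exact_mod_cast hn
  set e := a₀ - (1 / (2 * (n : ℝ))) •
      ∑ i, (gradient (fPos (a i)) xs + gradient (fNeg (a i)) xs) with he_def
  set r := ‖xs.fst‖ with hr_def
  set A := 1 / (n : ℝ) * ∑ i, (inner ℝ (a i).1 xs.fst) ^ 2 with hA
  set B := 1 / (n : ℝ) * ∑ i, (inner ℝ (a i).2 xs.snd) ^ 2 with hB
  have hA0 : 0 ≤ A := by positivity
  have hB0 : 0 ≤ B := by positivity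
  -- Twice a product is at most the sum of the squares. The constant from `lower_self` is needed:
  -- `lower` at `xs` would give only about 0.778, too little for the sign change.
  have hAB : 1.16 * r ^ 2 ≤ A + B := by
    have h := hreg.lower_self
    have hle : ∑ i, |crossForm xs xs (a i)|
        ≤ ∑ i, (inner ℝ (a i).1 xs.fst) ^ 2 + ∑ i, (inner ℝ (a i).2 xs.snd) ^ 2 := by
      rw [← Finset.sum_add_distrib]
      refine Finset.sum_le_sum fun i _ => ?_
      unfold crossForm
      rw [abs_le]
      constructor
      · nlinarith [sq_nonneg (inner ℝ (a i).1 xs.fst + inner ℝ (a i).2 xs.snd)]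
      · nlinarith [sq_nonneg (inner ℝ (a i).1 xs.fst - inner ℝ (a i).2 xs.snd)]
    rw [hA, hB, ← mul_add, one_div, inv_mul_eq_div, le_div_iff₀ hn0]
    linarith
  set ψ : ℝ → ℝ := fun t => t * inner ℝ e.fst xs.fst - t⁻¹ * inner ℝ e.snd xs.snd
    + 1 / 2 * ((1 - t) * t * A - (1 - t⁻¹) * t⁻¹ * B) with hψ
  have hgap : ∀ t, anchorGap xs a a₀ t (flip (rescale xs t)) = ψ t := by
    intro t
    rw [anchorGap_eq, ← he_def, inner_eq_inner_fst_add]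
    have hf1 : (flip (rescale xs t)).fst = t • xs.fst := rfl
    have hf2 : (flip (rescale xs t)).snd = -(t⁻¹ • xs.snd) := rfl
    simp only [hf1, hf2, inner_smul_right, inner_neg_right, hψ, hA, hB]
    have s1 : ∑ i, inner ℝ (a i).1 xs.fst * (t * inner ℝ (a i).1 xs.fst)
        = t * ∑ i, (inner ℝ (a i).1 xs.fst) ^ 2 := by
      rw [Finset.mul_sum]
      exact Finset.sum_congr rfl fun i _ => by ring
    have s2 : ∑ i, inner ℝ (a i).2 xs.snd * -(t⁻¹ * inner ℝ (a i).2 xs.snd)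
        = -t⁻¹ * ∑ i, (inner ℝ (a i).2 xs.snd) ^ 2 := by
      rw [Finset.mul_sum]
      exact Finset.sum_congr rfl fun i _ => by ring
    rw [s1, s2]
    field_simp
    ring
  have hcont : ContinuousOn ψ (Set.Icc 0.9 1.1) := by
    have hinv : ContinuousOn (fun t : ℝ => t⁻¹) (Set.Icc 0.9 1.1) :=
      continuousOn_id.inv₀ fun t ht => by
        have : (0.9 : ℝ) ≤ t := ht.1
        simp only [id]
        linarith
    simp only [hψ]
    fun_prop
  have hm : ‖e.fst‖ + ‖e.snd‖ ≤ 0.04 * r := by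
    linarith [norm_fst_add_norm_snd_le e]
  have hb1 := abs_le.1 (abs_real_inner_le_norm e.fst xs.fst)
  have hb2 := abs_le.1 (abs_real_inner_le_norm e.snd xs.snd)
  rw [← hbal] at hb2
  have hmr : ‖e.fst‖ * r + ‖e.snd‖ * r ≤ 0.04 * r ^ 2 := by nlinarith
  have hr2 : 0 < r ^ 2 := by positivity
  have he1 : 0 ≤ ‖e.fst‖ * r := by positivity
  have he2 : 0 ≤ ‖e.snd‖ * r := by positivity
  -- The quadratic part is at least 0.045·1.16 r², against an oracle error of at most (0.04/0.9) r².
  -- At 1.1 the margin is about 0.0479 against 0.044.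
  have hlo : 0 ≤ ψ 0.9 := by
    simp only [hψ]
    norm_num
    linarith
  have hhi : ψ 1.1 ≤ 0 := by
    simp only [hψ]
    norm_num
    linarith
  obtain ⟨t, ht, hψt⟩ := intermediate_value_Icc' (by norm_num) hcont ⟨hhi, hlo⟩
  exact ⟨t, ht, (hgap t).trans hψt⟩

theorem anchorGap_rescaled_lt {xs : Cat d₁ d₂} (h0 : xs.fst ≠ 0)
    (hbal : ‖xs.fst‖ = ‖xs.snd‖) (hn : 0 < n) {a : Fin n → Vec d₁ × Vec d₂}
    (hreg : RegularSample xs a) {a₀ : Cat d₁ d₂}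
    (he : ‖a₀ - (1 / (2 * (n : ℝ))) •
      ∑ i, (gradient (fPos (a i)) xs + gradient (fNeg (a i)) xs)‖ ≤ 0.0282 * ‖xs.fst‖)
    {t : ℝ} (ht : t ∈ Set.Icc (0.9 : ℝ) 1.1) {w : Cat d₁ d₂} (hw : w ≠ 0)
    (hflip : inner ℝ w (flip xs) = (0 : ℝ)) :
    anchorGap xs a a₀ t (rescale w t) < 1 / n * ∑ i, 1 / 2 * |crossForm xs w (a i)| := by
  have hr : 0 < ‖xs.fst‖ := norm_pos_iff.2 h0
  have hn0 : (0 : ℝ) < n := by exact_mod_cast hn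
  have hw0 : 0 < ‖w‖ := norm_pos_iff.2 hw
  have ht0 : 0 < t := by linarith [ht.1]
  have hti : t⁻¹ ≤ 1.112 := by
    rw [inv_le_comm₀ ht0 (by norm_num)]
    exact le_trans (by norm_num) ht.1
  have hti' : 0.9 ≤ t⁻¹ := by
    rw [le_inv_comm₀ (by norm_num) ht0]
    exact ht.2.trans (by norm_num)
  have hnorm : ‖rescale w t‖ ≤ 1.112 * ‖w‖ := by
    refine abs_le_of_sq_le_sq' ?_ (by positivity) |>.2
    rw [mul_pow, norm_sq_eq_add, norm_sq_eq_add w]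
    have hf1 : (rescale w t).fst = t • w.fst := rfl
    have hf2 : (rescale w t).snd = t⁻¹ • w.snd := rfl
    rw [hf1, hf2, norm_smul, norm_smul, Real.norm_eq_abs, Real.norm_eq_abs, abs_of_pos ht0,
      abs_of_pos (inv_pos.2 ht0), mul_pow, mul_pow, mul_add]
    have h1 : t ≤ 1.112 := ht.2.trans (by norm_num)
    gcongr
  have hlin : inner ℝ (a₀ - (1 / (2 * (n : ℝ))) •
      ∑ i, (gradient (fPos (a i)) xs + gradient (fNeg (a i)) xs)) (rescale w t)
      ≤ 0.0314 * ‖xs.fst‖ * ‖w‖ := by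
    refine (real_inner_le_norm _ _).trans ?_
    calc _ ≤ (0.0282 * ‖xs.fst‖) * (1.112 * ‖w‖) := by gcongr
      _ ≤ _ := by nlinarith [mul_pos hr hw0]
  have hS₁ : |∑ i, inner ℝ (a i).1 xs.fst * inner ℝ (a i).1 w.fst|
      ≤ n * (2 * ‖xs.fst‖ * ‖w.fst‖) := (Finset.abs_sum_le_sum_abs _ _).trans
    (sum_abs_inner_mul_inner_le hreg.upper_fst hreg.upper_fst _ _)
  have hS₂ : |∑ i, inner ℝ (a i).2 xs.snd * inner ℝ (a i).2 w.snd|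
      ≤ n * (2 * ‖xs.fst‖ * ‖w.snd‖) := by
    rw [hbal]
    exact (Finset.abs_sum_le_sum_abs _ _).trans
      (sum_abs_inner_mul_inner_le hreg.upper_snd hreg.upper_snd _ _)
  set S₁ := ∑ i, inner ℝ (a i).1 xs.fst * inner ℝ (a i).1 w.fst
  set S₂ := ∑ i, inner ℝ (a i).2 xs.snd * inner ℝ (a i).2 w.snd
  have hc₁ : |(1 - t) * t| ≤ 0.124 := by
    rw [abs_le]
    constructor <;> nlinarith [ht.1, ht.2]
  have hc₂ : |(1 - t⁻¹) * t⁻¹| ≤ 0.125 := by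
    rw [abs_le]
    constructor <;> nlinarith
  have hquad : (1 - t) * t * S₁ + (1 - t⁻¹) * t⁻¹ * S₂ ≤ n * (0.354 * ‖xs.fst‖ * ‖w‖) := by
    calc (1 - t) * t * S₁ + (1 - t⁻¹) * t⁻¹ * S₂
        ≤ |(1 - t) * t| * |S₁| + |(1 - t⁻¹) * t⁻¹| * |S₂| := by
          rw [← abs_mul, ← abs_mul]
          exact add_le_add (le_abs_self _) (le_abs_self _)
      _ ≤ 0.125 * (n * (2 * ‖xs.fst‖ * ‖w.fst‖)) + 0.125 * (n * (2 * ‖xs.fst‖ * ‖w.snd‖)) := by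
          have : |(1 - t) * t| ≤ 0.125 := hc₁.trans (by norm_num)
          gcongr
      _ = n * (0.25 * ‖xs.fst‖ * (‖w.fst‖ + ‖w.snd‖)) := by ring
      _ ≤ n * (0.25 * ‖xs.fst‖ * (1.415 * ‖w‖)) := by
          gcongr
          exact norm_fst_add_norm_snd_le w
      _ ≤ n * (0.354 * ‖xs.fst‖ * ‖w‖) := by
          refine mul_le_mul_of_nonneg_left ?_ hn0.le
          nlinarith [mul_pos hr hw0]
  have hlow := hreg.lower w hflip
  have heq : anchorGap xs a a₀ t (rescale w t) = inner ℝ (a₀ - (1 / (2 * (n : ℝ))) •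
      ∑ i, (gradient (fPos (a i)) xs + gradient (fNeg (a i)) xs)) (rescale w t)
      + 1 / (2 * n) * ((1 - t) * t * S₁ + (1 - t⁻¹) * t⁻¹ * S₂) := by
    rw [anchorGap_eq]
    have hf1 : (rescale w t).fst = t • w.fst := rfl
    have hf2 : (rescale w t).snd = t⁻¹ • w.snd := rfl
    simp only [hf1, hf2, inner_smul_right, mul_left_comm _ t, mul_left_comm _ t⁻¹,
      ← Finset.mul_sum, S₁, S₂]
    ring
  have hb : 1 / (2 * (n : ℝ)) * ((1 - t) * t * S₁ + (1 - t⁻¹) * t⁻¹ * S₂)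
      ≤ 0.177 * ‖xs.fst‖ * ‖w‖ := by
    rw [one_div, inv_mul_eq_div, div_le_iff₀ (by positivity)]
    linarith
  have hR : 0.275 * ‖xs.fst‖ * ‖w‖ ≤ 1 / n * ∑ i, 1 / 2 * |crossForm xs w (a i)| := by
    rw [← Finset.mul_sum, one_div (n : ℝ), inv_mul_eq_div, le_div_iff₀ hn0]
    linarith
  rw [heq]
  -- The budget is 0.0314 + 0.177 < 0.275.
  nlinarith [mul_pos hr hw0]

theorem solutions_eq_singleton_rescale {xs : Cat d₁ d₂} (h0 : xs.fst ≠ 0)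
    (hbal : ‖xs.fst‖ = ‖xs.snd‖) (hn : 0 < n) {a : Fin n → Vec d₁ × Vec d₂}
    (hreg : RegularSample xs a) {a₀ : Cat d₁ d₂}
    (he : ‖a₀ - (1 / (2 * (n : ℝ))) •
      ∑ i, (gradient (fPos (a i)) xs + gradient (fNeg (a i)) xs)‖ ≤ 0.0282 * ‖xs.fst‖) :
    ∃ t : ℝ, t ≠ 0 ∧
      solutions a (fun i => measurement xs (a i)) a₀ = {rescale xs t} := by
  obtain ⟨t, ht, hgap⟩ := exists_anchorGap_flip_rescale_eq_zero h0 hbal hn hreg he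
  have hn0 : (0 : ℝ) < n := by exact_mod_cast hn
  have hr : 0 < ‖xs.fst‖ := norm_pos_iff.2 h0
  have ht0 : t ≠ 0 := by linarith [ht.1]
  have htt : t * t⁻¹ = 1 := mul_inv_cancel₀ ht0
  have hstrict : ∀ z : Cat d₁ d₂, z ≠ 0 →
      objective a (fun i => measurement xs (a i)) a₀ (rescale xs t + z)
        < objective a (fun i => measurement xs (a i)) a₀ (rescale xs t) := by
    intro z hz
    -- Undoing the rescaling turns the tangent direction into `flip xs`. Projecting it off leaves
    -- `w`, and the measurement's differential at `rescale xs t` along `z` becomes `crossForm xs w`.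
    set y : Cat d₁ d₂ := rescale z t⁻¹ with hy
    have hflip0 : inner ℝ (flip xs) (flip xs) = 2 * ‖xs.fst‖ ^ 2 := by
      rw [inner_flip]
      have hf1 : (flip xs).fst = xs.fst := rfl
      have hf2 : (flip xs).snd = -xs.snd := rfl
      rw [hf1, hf2, inner_neg_right, real_inner_self_eq_norm_sq, real_inner_self_eq_norm_sq, hbal]
      ring
    set s : ℝ := inner ℝ y (flip xs) / (2 * ‖xs.fst‖ ^ 2) with hs
    set w : Cat d₁ d₂ := y - s • flip xs with hw
    have hwflip : inner ℝ w (flip xs) = (0 : ℝ) := by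
      rw [hw, inner_sub_left, inner_smul_left, hflip0, hs]
      simp only [conj_trivial]
      field_simp
      ring
    have hz1 : z.fst = t • w.fst + (s * t) • xs.fst := by
      have : w.fst = t⁻¹ • z.fst - s • xs.fst := rfl
      rw [this, smul_sub, smul_smul, smul_smul, htt, one_smul, mul_comm t s]
      abel
    have hz2 : z.snd = t⁻¹ • w.snd - (s * t⁻¹) • xs.snd := by
      have : w.snd = t⁻¹⁻¹ • z.snd - s • (-xs.snd) := rfl
      rw [this, inv_inv, smul_neg, sub_neg_eq_add, smul_add, smul_smul, smul_smul, mul_comm t⁻¹ t,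
        htt, one_smul, mul_comm t⁻¹ s]
      abel
    have hzdec : z = rescale w t + s • flip (rescale xs t) := by
      have h1 : (rescale w t + s • flip (rescale xs t)).fst = t • w.fst + s • t • xs.fst := rfl
      have h2 : (rescale w t + s • flip (rescale xs t)).snd
        = t⁻¹ • w.snd + s • -(t⁻¹ • xs.snd) := rfl
      refine (WithLp.ofLp_injective 2) (Prod.ext ?_ ?_)
      · refine hz1.trans (Eq.trans ?_ h1.symm)
        rw [smul_smul]
      · refine hz2.trans (Eq.trans ?_ h2.symm)
        rw [smul_neg, smul_smul, sub_eq_add_neg]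
    have hgapz : anchorGap xs a a₀ t z = anchorGap xs a a₀ t (rescale w t) := by
      rw [hzdec, anchorGap_add, anchorGap_smul, hgap, mul_zero, add_zero]
    have hcross : ∀ i, t * inner ℝ (a i).1 xs.fst * inner ℝ (a i).2 z.snd
        + t⁻¹ * inner ℝ (a i).2 xs.snd * inner ℝ (a i).1 z.fst = crossForm xs w (a i) := by
      intro i
      rw [hz1, hz2]
      simp only [crossForm, inner_add_right, inner_sub_right, inner_smul_right]
      linear_combination (inner ℝ (a i).1 xs.fst * inner ℝ (a i).2 w.snd
        + inner ℝ (a i).2 xs.snd * inner ℝ (a i).1 w.fst) * htt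
    -- For `z` along the tangent all first-order terms vanish. A maximum is at least the mean of its
    -- arguments, which leaves the quadratic term; it is positive because some measurement of `xs`
    -- is nonzero.
    by_cases hw0 : w = 0
    · have hle := objective_rescale_add_sub_le xs a a₀ z ht0
        (c := fun i => 1 / 4 * ((inner ℝ (a i).1 z.fst) ^ 2 + (inner ℝ (a i).2 z.snd) ^ 2))
        fun i => by
          rw [hcross i, le_max_iff]
          by_contra! hcon
          linarith [hcon.1, hcon.2]
      have hgap0 : anchorGap xs a a₀ t z = 0 := by
        rw [hgapz, hw0, show rescale (0 : Cat d₁ d₂) t = (0 : ℝ) • (0 : Cat d₁ d₂) from ?_,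
          anchorGap_smul, zero_mul]
        rw [zero_smul]
        refine (WithLp.ofLp_injective 2) (Prod.ext ?_ ?_)
        · exact smul_zero t
        · exact smul_zero t⁻¹
      have hs0 : s ≠ 0 := by
        rintro hs0
        refine hz ?_
        rw [hzdec, hs0, hw0, zero_smul, add_zero]
        refine (WithLp.ofLp_injective 2) (Prod.ext ?_ ?_)
        · exact smul_zero t
        · exact smul_zero t⁻¹
      have hpos : 0 < ∑ i, 1 / 4 * ((inner ℝ (a i).1 z.fst) ^ 2
          + (inner ℝ (a i).2 z.snd) ^ 2) := by
        have hself : 0 < ∑ i, |crossForm xs xs (a i)| :=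
          lt_of_lt_of_le (by positivity) hreg.lower_self
        obtain ⟨i, -, hi⟩ := Finset.exists_lt_of_sum_lt
          (f := fun _ : Fin n => (0 : ℝ)) (by simpa using hself)
        refine Finset.sum_pos' (fun i _ => by positivity) ⟨i, Finset.mem_univ i, ?_⟩
        have hα : inner ℝ (a i).1 xs.fst ≠ (0 : ℝ) := by
          intro hα
          simp [crossForm, hα] at hi
        have hw1 : w.fst = 0 := by rw [hw0]; rfl
        have hp : inner ℝ (a i).1 z.fst = s * t * inner ℝ (a i).1 xs.fst := by
          rw [hz1, hw1, smul_zero, zero_add, inner_smul_right]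
        rw [hp]
        positivity
      have : 0 < 1 / (n : ℝ) * ∑ i, 1 / 4 * ((inner ℝ (a i).1 z.fst) ^ 2
          + (inner ℝ (a i).2 z.snd) ^ 2) := by positivity
      linarith
    -- Here the squares are dropped, and the argument of the maximum is chosen by the sign of
    -- `crossForm`.
    · have hle := objective_rescale_add_sub_le xs a a₀ z ht0
        (c := fun i => 1 / 2 * |crossForm xs w (a i)|)
        fun i => by
          rw [hcross i, le_max_iff]
          rcases abs_cases (crossForm xs w (a i)) with ⟨h, -⟩ | ⟨h, -⟩
          · left
            rw [h]
            linarith [sq_nonneg (inner ℝ (a i).1 z.fst + inner ℝ (a i).2 z.snd)]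
          · right
            rw [h]
            linarith [sq_nonneg (inner ℝ (a i).1 z.fst - inner ℝ (a i).2 z.snd)]
      have := anchorGap_rescaled_lt h0 hbal hn hreg he ht hw0 hwflip
      linarith
  refine ⟨t, ht0, Set.eq_singleton_iff_unique_mem.2 ⟨fun x => ?_, fun x hx => ?_⟩⟩
  · by_cases hx : x - rescale xs t = 0
    · rw [sub_eq_zero.1 hx]
    · have := hstrict _ hx
      rw [add_sub_cancel] at this
      exact this.le
  · by_contra hne
    have := hstrict _ (sub_ne_zero.2 hne)
    rw [add_sub_cancel] at this
    exact absurd (hx (rescale xs t)) (not_le.2 this)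

theorem closestEquivalents_eq_singleton {xs x : Cat d₁ d₂} (hx : x ∈ equivalents xs) :
    closestEquivalents xs x = {x} := by
  refine Set.eq_singleton_iff_unique_mem.2 ⟨⟨hx, fun x' _ => ?_⟩, fun x' hx' => ?_⟩
  · rw [sub_self, norm_zero]
    exact norm_nonneg _
  · have := hx'.2 x hx
    rw [sub_self, norm_zero, norm_le_zero_iff, sub_eq_zero] at this
    exact this.symm

end Recovery

end BilinearRegression

theorem theorem2 :
    ∃ C : ℝ, 0 < C ∧
      ∀ (d₁ d₂ n : ℕ) (ε δ : ℝ),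
        7 / 8 ≤ ε → ε < 1 → 0 < δ → δ ≤ 1 →
        C * ε ^ (-4 : ℤ) * max ((d₁ + d₂ : ℕ) : ℝ) (Real.log (8 / δ)) ≤ (n : ℝ) →
      ∀ (xs : BilinearRegression.Cat d₁ d₂),
        xs.fst ≠ 0 → xs.snd ≠ 0 → ‖xs.fst‖ = ‖xs.snd‖ →
      ∀ {Ω : Type*} [MeasurableSpace Ω] (μ : Measure Ω) [IsProbabilityMeasure μ]
        (a₁ : Fin n → Ω → BilinearRegression.Vec d₁)
        (a₂ : Fin n → Ω → BilinearRegression.Vec d₂),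
        (∀ i, HasLaw (a₁ i) (stdGaussian (BilinearRegression.Vec d₁)) μ) →
        (∀ i, HasLaw (a₂ i) (stdGaussian (BilinearRegression.Vec d₂)) μ) →
        (∀ i, IndepFun (a₁ i) (a₂ i) μ) →
        iIndepFun (fun i ω => (a₁ i ω, a₂ i ω)) μ →
      ∃ E : Set Ω, MeasurableSet E ∧ ENNReal.ofReal (1 - δ) ≤ μ E ∧
        ∀ ω ∈ E, ∀ a₀ : BilinearRegression.Cat d₁ d₂,
          BilinearRegression.ApproxOracle ε xs (fun i => (a₁ i ω, a₂ i ω)) a₀ →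
          ∃ xh : BilinearRegression.Cat d₁ d₂,
            BilinearRegression.solutions (fun i => (a₁ i ω, a₂ i ω))
              (fun i => BilinearRegression.measurement xs (a₁ i ω, a₂ i ω)) a₀ = {xh} ∧
            BilinearRegression.closestEquivalents xs xh = {xh} := by
  refine ⟨12000, by norm_num, ?_⟩
  intro d₁ d₂ n ε δ hε hε1 hδ hδ1 hn xs h0 h0' hbal Ω _ μ _ a₁ a₂ hl₁ hl₂ h12 hindep
  have hlaw : ∀ i, HasLaw (fun ω => (a₁ i ω, a₂ i ω)) (BilinearRegression.dataLaw d₁ d₂) μ :=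
    fun i => (h12 i).hasLaw_prod (hl₁ i) (hl₂ i)
  have hr : 0 < ‖xs.fst‖ := norm_pos_iff.2 h0
  have hnpos : 0 < n := by
    have hlog : 0 < Real.log (8 / δ) :=
      Real.log_pos ((one_lt_div hδ).2 (by linarith))
    have : (0 : ℝ) < n := lt_of_lt_of_le (mul_pos (by positivity)
      (lt_max_of_lt_right hlog)) hn
    exact_mod_cast this
  set bad : Set Ω :=
    {ω | ¬ BilinearRegression.RegularSample xs fun i => (a₁ i ω, a₂ i ω)} with hbad
  have hprob : μ.real bad ≤ δ :=
    (BilinearRegression.measureReal_not_regularSample_le h0 hbal hlaw hindep).trans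
      (BilinearRegression.failure_probability_le hε hε1 hδ hn)
  -- A measurable hull of the bad set has the same measure, so measurability of `bad` itself is not
  -- needed.
  refine ⟨(toMeasurable μ bad)ᶜ, (measurableSet_toMeasurable μ bad).compl, ?_, ?_⟩
  · rw [prob_compl_eq_one_sub (measurableSet_toMeasurable μ bad), measure_toMeasurable,
      ENNReal.ofReal_sub 1 hδ.le, ENNReal.ofReal_one]
    exact tsub_le_tsub_left
      ((ENNReal.le_ofReal_iff_toReal_le (measure_ne_top μ bad) hδ.le).2 hprob) 1
  · intro ω hω a₀ ha₀
    have hreg : BilinearRegression.RegularSample xs fun i => (a₁ i ω, a₂ i ω) := by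
      by_contra hcon
      exact hω (subset_toMeasurable μ bad hcon)
    -- The condition ε ≥ 7/8 enters here, as (1 - ε)/2 ≤ 1/16.
    have he := ha₀.trans (show (1 - ε) / 2 * BilinearRegression.lambdaD xs
        ≤ 0.0282 * ‖xs.fst‖ by
      calc (1 - ε) / 2 * BilinearRegression.lambdaD xs
          ≤ (1 - ε) / 2 * (0.451 * ‖xs.fst‖) :=
            mul_le_mul_of_nonneg_left (BilinearRegression.lambdaD_le h0 hbal) (by linarith)
        _ ≤ 1 / 16 * (0.451 * ‖xs.fst‖) :=
            mul_le_mul_of_nonneg_right (by linarith) (by positivity)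
        _ ≤ 0.0282 * ‖xs.fst‖ := by linarith)
    obtain ⟨t, ht, hsol⟩ :=
      BilinearRegression.solutions_eq_singleton_rescale h0 hbal hnpos hreg he
    exact ⟨_, hsol, BilinearRegression.closestEquivalents_eq_singleton ⟨t, ht, rfl, rfl⟩⟩
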